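/- **Setting.** Let $d,T\ge 1$, let $\|\cdot\|$ be any norm on $\mathbb R^d$ and $\|\cdot\|_2$ the Euclidean norm, with unit ball $\mathbb B$ and unit sphere $\mathbb S$. Let $\mathcal W\subseteq\mathbb R^d$ be closed and convex, with non-empty interior and $0\in\mathcal W$. In each round $t=1,\dots,T$ a learner plays $w_t\in\mathcal W$; simultaneously a possibly randomized environment, which may adapt to the previous rounds, picks a convex $\ell_t:\mathcal W\to\mathbb R$ with $\ell_t(0)=0$ that is $L$-Lipschitz with respect to $\|\cdot\|_2$, where $L\ge1$; the learner then observes $\ell_t(w_t)$ only. For $u\in\mathcal W$ put $\mathcal R_T(u)=\sum_{t=1}^T(\ell_t(w_t)-\ell_t(u))$. The loss $\ell_t$ is $\beta$-smooth if it is differentiable on $\mathcal W$ and $\ell_t(y)\le \ell_t(x)+\langle\nabla\ell_t(x),y-x\rangle+\frac\beta2\|x-y\|_2^2$ for all $x,y\in\mathcal W$. **Scale learner (Interface 1).** $\mathcal A_{\mathcal V}$ is a deterministic one-dimensional online algorithm for a segment $l\subseteq(0,\infty)$ and a bound $L_{\mathcal V}$: in round $t$ it plays a number $v_t$ that is a function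 of the previous loss values $g_1,\dots,g_{t-1}$, and for all loss values with $|g_t|\le L_{\mathcal V}$ it satisfies $v_t\in l$ and, for every $\hat v\in l$, $\sum_{t=1}^T(v_t-\hat v)g_t\le C\log^{k}(e+T+|\hat v|+L_{\mathcal V})\,(1+|\hat v|L_{\mathcal V}\sqrt T)$, that is, $\widetilde O(1+|\hat v|L_{\mathcal V}\sqrt T)$. **Algorithm.** Inputs: $\mathcal A_{\mathcal V}$, $\delta\in(0,1]$, $\alpha\in[0,1]$, a closed convex $\mathcal Z\subseteq\mathbb B$, and $\eta=\sqrt{\delta^2/(4(dL)^2T)}$. Set $z_1=0$. In round $t$: get $v_t$ from $\mathcal A_{\mathcal V}$; draw $s_t$ uniformly from $\mathbb S$, independently of the past and of $\ell_t$; play $w_t=v_t(z_t+\delta s_t)$; set $\hat g_t=\frac{d}{v_t\delta}\ell_t(w_t)s_t$ and $\bar\ell_t(v)=v\langle z_t,\hat g_t\rangle+\rho(v)$, where the regularizer is $\rho(v)=2\delta L|v|$ in the Lipschitz version and $\rho(v)=\beta\delta^2v^2$ in the smooth version; send $\partial\bar\ell_t(v_t)$ to $\mathcal A_{\mathcal V}$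 as its $t$-th loss value; set $z_{t+1}=\operatorname{argmin}_{z\in(1-\alpha)\mathcal Z}\ \eta\langle z,\hat g_t\rangle+\|z_t-z\|_2^2$. **Lemma.** For all $C,k$ there are $C',k'$, depending on $C$ and $k$ only, such that the following holds. Suppose that $\mathcal A_{\mathcal V}$ is a scale learner with constants $C,k$ for $l\subseteq(0,\infty)$ and $L_{\mathcal V}$, and that almost surely $w_t\in\mathcal W$ and $|\partial\bar\ell_t(v_t)|\le L_{\mathcal V}$ for all $t\le T$. Let $u\in\mathcal W$ and $r>0$ be such that $\|u\|/r\in l$ and $ru/\|u\|\in\mathcal Z$, and put $\Lambda=\log^{k'}(e+T+\|u\|/r+L_{\mathcal V})$. Then $\mathcal R_T(u)$ is integrable, and the Lipschitz version of the algorithm satisfies $$\mathbb E[\mathcal R_T(u)]\le C'\Lambda\left(1+T\delta L\frac{\|u\|}{r}+\frac{\|u\|}{r}L_{\mathcal V}\sqrt T+\frac{\|u\|dL}{r\delta}\sqrt T+\alpha\|u\|_2TL\right).$$ If moreover all $\ell_t$ are $\beta$-smooth, with $\beta\ge1$, then under the same assumptions on its own $w_t$ and $\bar\ell_t$ the smooth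 version satisfies $$\mathbb E[\mathcal R_T(u)]\le C'\Lambda\left(1+T\beta\delta^2\Big(\frac{\|u\|}{r}\Big)^2+\frac{\|u\|}{r}L_{\mathcal V}\sqrt T+\frac{\|u\|}{r}\frac{dL}{\delta}\sqrt T+\alpha\|u\|_2TL\right),$$ and there too $\mathcal R_T(u)$ is integrable. -/

import Mathlib

open MeasureTheory ProbabilityTheory
open scoped Pointwise

noncomputable section

namespace ConvexBandit

/-- `ℝ^d` with the Euclidean norm, written `‖·‖` below. -/
abbrev Vec (d : ℕ) : Type := EuclideanSpace ℝ (Fin d)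

/-- The polylogarithmic factor `log (e + x) ^ k` hidden by the `Õ` notation. -/
def logFactor (k : ℕ) (x : ℝ) : ℝ := Real.log (Real.exp 1 + x) ^ k

/-! ### The scale learner -/

/-- A one-dimensional online learning algorithm: in round `t` (rounds are numbered from `0`) it
plays a number that is a function of the `t` loss values received so far. -/
abbrev ScalingAlg : Type := (t : ℕ) → (Fin t → ℝ) → ℝ

/-- The number played in round `t` against the sequence `g` of loss values. -/
def ScalingAlg.run (V : ScalingAlg) (g : ℕ → ℝ) (t : ℕ) : ℝ := V t (fun i => g i)

/-- The scale learning interface for `T` rounds on the segment `l`, with loss values bounded by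
`LV`: all plays are in `l`, and the regret against every `v ∈ l` is
`Õ (1 + |v| LV √T)`, where `C` and `k` are the constant and the power of the logarithm
hidden in `Õ`. -/
structure ImplementsScaling (V : ScalingAlg) (l : Set ℝ) (T : ℕ) (LV C : ℝ) (k : ℕ) : Prop where
  segment : l.OrdConnected
  mem : ∀ g : ℕ → ℝ, (∀ t < T, |g t| ≤ LV) → ∀ t < T, V.run g t ∈ l
  regret_le : ∀ g : ℕ → ℝ, (∀ t < T, |g t| ≤ LV) → ∀ v ∈ l,
    ∑ t ∈ Finset.range T, (V.run g t - v) * g t ≤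
      C * logFactor k (T + |v| + LV) * (1 + |v| * LV * √(T : ℝ))

/-! ### The algorithm -/

/-- A minimizer of `f` over `S` (an arbitrary point if there is none). -/
def argminOn {d : ℕ} (S : Set (Vec d)) (f : Vec d → ℝ) : Vec d :=
  Classical.epsilon fun z => z ∈ S ∧ IsMinOn f S z

/-- The inputs of the black-box comparator-adaptive convex bandit algorithm. `reg` is the
regularizer in the surrogate loss: `lipReg` in the general Lipschitz case and `smoothReg` in the
smooth case. -/
structure Input (d : ℕ) where
  V : ScalingAlg
  δ : ℝ
  α : ℝ
  η : ℝ
  Z : Set (Vec d)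
  reg : ℝ → ℝ

/-- The regularizer `2 δ L |v|`, used for Lipschitz losses. -/
def lipReg (δ L : ℝ) (v : ℝ) : ℝ := 2 * δ * L * |v|

/-- The regularizer `β δ² v²`, used for `β`-smooth losses. -/
def smoothReg (δ β : ℝ) (v : ℝ) : ℝ := β * δ ^ 2 * v ^ 2

/-- The learning rate `√(δ² / (4 (d L)² T))`. -/
def learningRate (d : ℕ) (δ L : ℝ) (T : ℕ) : ℝ := √(δ ^ 2 / (4 * (d * L) ^ 2 * T))

namespace Input

variable {d : ℕ} (A : Input d)

/-- The point `v (z + δ s)` played from scale `v`, direction `z` and sample `s`. -/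
def point (v : ℝ) (z s : Vec d) : Vec d := v • (z + A.δ • s)

/-- The one-point gradient estimate `(d / (v δ)) ℓ(w) s` at `w = v (z + δ s)`. -/
def estimate (f : Vec d → ℝ) (v : ℝ) (z s : Vec d) : Vec d :=
  ((d : ℝ) / (v * A.δ) * f (A.point v z s)) • s

/-- The surrogate loss `v ↦ v ⟨z, ĝ⟩ + reg v`. -/
def surrogate (z ghat : Vec d) (v : ℝ) : ℝ := v * inner ℝ z ghat + A.reg v

/-- The online gradient descent step: the minimizer of `η ⟨y, ĝ⟩ + ‖z - y‖²` over
`y ∈ (1 - α) Z`. -/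
def step (z ghat : Vec d) : Vec d :=
  argminOn ((1 - A.α) • A.Z) fun y => A.η * inner ℝ y ghat + ‖z - y‖ ^ 2

/-- The state at the beginning of round `t`, on the losses `f` and the samples `s`: the direction
`z_t`, and the loss values sent so far to the scale learner. The value sent in a round is the
derivative of the surrogate loss at the current scale `v`; both regularizers are convex and are
differentiable at `v > 0`, so it is the only subgradient there. -/
def state (f : ℕ → Vec d → ℝ) (s : ℕ → Vec d) : (t : ℕ) → Vec d × (Fin t → ℝ)
  | 0 => (0, Fin.elim0)
  | t + 1 =>
    let z := (state f s t).1
    let h := (state f s t).2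
    let v := A.V t h
    let ghat := A.estimate (f t) v z (s t)
    (A.step z ghat, Fin.snoc h (deriv (A.surrogate z ghat) v))

/-- The direction `z_t`. -/
def dir (f : ℕ → Vec d → ℝ) (s : ℕ → Vec d) (t : ℕ) : Vec d := (A.state f s t).1

/-- The scale `v_t`. -/
def scale (f : ℕ → Vec d → ℝ) (s : ℕ → Vec d) (t : ℕ) : ℝ := A.V t (A.state f s t).2

/-- The point `w_t` played in round `t`. -/
def play (f : ℕ → Vec d → ℝ) (s : ℕ → Vec d) (t : ℕ) : Vec d :=
  A.point (A.scale f s t) (A.dir f s t) (s t)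

/-- The gradient estimate `ĝ_t`. -/
def gradEst (f : ℕ → Vec d → ℝ) (s : ℕ → Vec d) (t : ℕ) : Vec d :=
  A.estimate (f t) (A.scale f s t) (A.dir f s t) (s t)

/-- The loss value sent to the scale learner in round `t`. -/
def feedback (f : ℕ → Vec d → ℝ) (s : ℕ → Vec d) (t : ℕ) : ℝ :=
  deriv (A.surrogate (A.dir f s t) (A.gradEst f s t)) (A.scale f s t)

theorem dir_zero (f : ℕ → Vec d → ℝ) (s : ℕ → Vec d) : A.dir f s 0 = 0 := rfl

theorem dir_succ (f : ℕ → Vec d → ℝ) (s : ℕ → Vec d) (t : ℕ) :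
    A.dir f s (t + 1) = A.step (A.dir f s t) (A.gradEst f s t) := rfl

theorem state_snd (f : ℕ → Vec d → ℝ) (s : ℕ → Vec d) (t : ℕ) :
    (A.state f s t).2 = fun i : Fin t => A.feedback f s i := by
  induction t with
  | zero => funext i; exact i.elim0
  | succ t ih =>
    funext i
    refine Fin.lastCases ?_ (fun j => ?_) i
    · simp [state, feedback, scale, gradEst, dir]
    · simp [state, ih]

theorem scale_eq (f : ℕ → Vec d → ℝ) (s : ℕ → Vec d) (t : ℕ) :
    A.scale f s t = A.V.run (A.feedback f s) t := by
  simp [scale, ScalingAlg.run, state_snd]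

/-- The regret `∑_{t < T} (f_t(w_t) - f_t(u))`. -/
def regret (T : ℕ) (u : Vec d) (f : ℕ → Vec d → ℝ) (s : ℕ → Vec d) : ℝ :=
  ∑ t ∈ Finset.range T, (f t (A.play f s t) - f t u)

end Input

/-! ### The environment and the samples -/

/-- `β`-smoothness over `W` (a convex set with interior points, so that the derivative within `W`
is unique). -/
def IsSmoothOver {d : ℕ} (β : ℝ) (f : Vec d → ℝ) (W : Set (Vec d)) : Prop :=
  DifferentiableOn ℝ f W ∧ ∀ x ∈ W, ∀ y ∈ W,
    f y ≤ f x + fderivWithin ℝ f W x (y - x) + β / 2 * ‖x - y‖ ^ 2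

/-- The uniform distribution on the Euclidean unit sphere. -/
def uniformSphere (d : ℕ) : Measure (Metric.sphere (0 : Vec d) 1) :=
  ((volume : Measure (Vec d)).toSphere Set.univ)⁻¹ • (volume : Measure (Vec d)).toSphere

/-- An adaptive, possibly randomized environment: in each round `t < T` it chooses a convex
`L`-Lipschitz loss on `W` vanishing at `0`, on the basis of the information `ℱ t` available before
round `t`. -/
structure IsEnvironment {d : ℕ} {Ω : Type*} {mΩ : MeasurableSpace Ω} (ℱ : Filtration ℕ mΩ)
    (T : ℕ) (W : Set (Vec d)) (L : ℝ) (loss : ℕ → Ω → Vec d → ℝ) : Prop where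
  measurable : ∀ t < T, ∀ x ∈ W, Measurable[ℱ t] fun ω => loss t ω x
  convex : ∀ t < T, ∀ ω, ConvexOn ℝ W (loss t ω)
  lipschitz : ∀ t < T, ∀ ω, ∀ x ∈ W, ∀ y ∈ W, |loss t ω y - loss t ω x| ≤ L * ‖y - x‖
  zero : ∀ t < T, ∀ ω, loss t ω 0 = 0

/-- In each round `t < T` the sample `s t` is uniform on the unit sphere and independent of the
information `ℱ t` from before round `t`; it is known from the next round on. -/
structure IsUniformSampling {d : ℕ} {Ω : Type*} {mΩ : MeasurableSpace Ω} (μ : Measure Ω)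
    (ℱ : Filtration ℕ mΩ) (T : ℕ) (s : ℕ → Ω → Metric.sphere (0 : Vec d) 1) : Prop where
  measurable : ∀ t < T, Measurable[ℱ (t + 1)] (s t)
  law : ∀ t < T, μ.map (s t) = uniformSphere d
  indep : ∀ t < T, Indep (MeasurableSpace.comap (s t) inferInstance) (ℱ t) μ

end ConvexBandit

end

/-! Fix a round and its past. With loss `f`, center `x = v_t z_t` and radius `ρ = v_t δ`, the play
is `w = x + ρ s` and the estimate is `ĝ = (d/ρ) f(w) s`. The core is `E f(w) - f(y) ≤ E ⟨x - y, ĝ⟩ +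
2κ` for every `y ∈ W`, where `κ` measures how far chords of the ball rise above `f`. The classical
argument, that `ĝ` is an unbiased gradient of a convex ball average, needs that average at `y`,
hence values of `f` outside `W`. Instead the ball around `x` is contracted towards `y`, which stays
in `W`. Convexity bounds the integral over the contracted ball from above; polar coordinates bound
it from below by the original integral plus a flux through the sphere. Dividing by the contraction
parameter and letting it tend to `0` gives an inequality between ball and sphere integrals
(`integral_sphere_le_of_convexOn`). The chord estimate trades the ball integral for the sphere
integral (`average_sphere_le_of_convexOn`). Here `κ = Lρ` for Lipschitz and `βρ²/2` for smooth
losses, so `2κ` is exactly the regularizer at `v_t`.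

It remains to bound the sum of `⟨v_t z_t - v y, ĝ_t⟩ + reg v_t` on each path
(`Input.sum_surrogate_le`), with `v = ‖u‖/r` and `y = (1-α) r u/‖u‖`. The inner product splits into
`(v_t - v)⟨z_t, ĝ_t⟩`, which with the regularizer is controlled by the scale learner, and `v ⟨z_t -
y, ĝ_t⟩`, which is the regret of projected gradient descent. Replacing the comparator `v y = (1-α)
u` by `u` costs `α‖u‖L` per round.

The passage to expectations uses that the sample is independent of the past and that the scale
learner's guarantee forces its plays to be bounded. -/

noncomputable section

namespace ConvexBandit

open Metric Set Module

/-! ### Spherical measure and polar coordinates. -/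

section Sphere

variable {E : Type*} [NormedAddCommGroup E] [NormedSpace ℝ E] [MeasurableSpace E] [BorelSpace E]
  [FiniteDimensional ℝ E] (μ : Measure E) [μ.IsAddHaarMeasure]

/-- Negation maps the cone over a set to the cone over its antipode, and Haar measure is even. This
symmetry annihilates means of linear functions and merges antipodal values. -/
theorem integral_toSphere_comp_neg (φ : sphere (0 : E) 1 → ℝ) :
    ∫ s, φ (-s) ∂μ.toSphere = ∫ s, φ s ∂μ.toSphere := by
  have hm : MeasurePreserving (fun s : sphere (0 : E) 1 => -s) μ.toSphere μ.toSphere := by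
    refine ⟨continuous_neg.measurable, Measure.ext fun A hA => ?_⟩
    rw [Measure.map_apply continuous_neg.measurable hA, μ.toSphere_apply' hA,
      μ.toSphere_apply' (continuous_neg.measurable hA)]
    congr 1
    rw [← Measure.measure_neg (μ := μ)]
    congr 1
    ext x
    simp only [Set.mem_neg, Set.mem_smul, mem_image, mem_preimage]
    constructor
    · rintro ⟨a, ha, _, ⟨y, hy, rfl⟩, h⟩
      exact ⟨a, ha, _, ⟨-y, hy, rfl⟩, by rw [coe_neg_sphere, smul_neg, h, neg_neg]⟩
    · rintro ⟨a, ha, _, ⟨y, hy, rfl⟩, h⟩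
      exact ⟨a, ha, _, ⟨-y, by rwa [neg_neg], rfl⟩, by rw [coe_neg_sphere, smul_neg, h]⟩
  exact hm.integral_comp (Homeomorph.neg _).measurableEmbedding φ

theorem integral_volumeIoiPow (n : ℕ) (f : ℝ → ℝ) :
    ∫ x : Ioi (0 : ℝ), f x ∂Measure.volumeIoiPow n = ∫ x in Ioi (0 : ℝ), x ^ n * f x := by
  simp only [Measure.volumeIoiPow, ENNReal.ofReal]
  rw [integral_withDensity_eq_integral_smul,
    integral_subtype_comap measurableSet_Ioi fun a ↦ Real.toNNReal (a ^ n) • f a,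
    setIntegral_congr_fun measurableSet_Ioi fun x hx ↦ ?_]
  · rw [NNReal.smul_def, Real.coe_toNNReal _ (pow_nonneg hx.out.le _), smul_eq_mul]
  · exact (measurable_subtype_coe.pow_const _).real_toNNReal

theorem integrable_polar {F : E → ℝ} (hF : Integrable F μ) :
    Integrable (fun p : sphere (0 : E) 1 × Ioi (0 : ℝ) => F ((p.2 : ℝ) • (p.1 : E)))
      (μ.toSphere.prod (Measure.volumeIoiPow (finrank ℝ E - 1))) := by
  have h := μ.measurePreserving_homeomorphUnitSphereProd.integrable_comp_emb
    (g := fun p => F ((p.2 : ℝ) • (p.1 : E))) (Homeomorph.measurableEmbedding _)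
  rw [← h]
  have h2 : IntegrableOn F ({(0 : E)}ᶜ) μ := hF.integrableOn
  rw [integrableOn_iff_comap_subtypeVal (by measurability)] at h2
  refine h2.congr (ae_of_all _ fun x => ?_)
  have hx : ‖(x : E)‖ ≠ 0 := norm_ne_zero_iff.2 x.2
  simp [smul_smul, hx]

theorem integrable_integral_toSphere {F : E → ℝ} (hF : Integrable F μ) :
    Integrable (fun s : sphere (0 : E) 1 =>
      ∫ ρ in Ioi (0 : ℝ), ρ ^ (finrank ℝ E - 1) * F (ρ • (s : E))) μ.toSphere := by
  have := (integrable_polar μ hF).integral_prod_left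
  simpa only [fun s : sphere (0 : E) 1 =>
    integral_volumeIoiPow (finrank ℝ E - 1) fun ρ => F (ρ • (s : E))] using this

variable [Nontrivial E]

/-- Integration in polar coordinates. -/
theorem integral_eq_integral_toSphere {F : E → ℝ} (hF : Integrable F μ) :
    ∫ x, F x ∂μ = ∫ s : sphere (0 : E) 1,
      (∫ ρ in Ioi (0 : ℝ), ρ ^ (finrank ℝ E - 1) * F (ρ • (s : E))) ∂μ.toSphere := by
  have h1 : ∫ x, F x ∂μ = ∫ x : ({(0)}ᶜ : Set E), F x ∂(μ.comap (↑)) := by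
    rw [integral_subtype_comap (measurableSet_singleton _).compl F, restrict_compl_singleton]
  have h2 := μ.measurePreserving_homeomorphUnitSphereProd.integral_comp
        (Homeomorph.measurableEmbedding _)
        (fun p : sphere (0 : E) 1 × Ioi (0 : ℝ) => F ((p.2 : ℝ) • (p.1 : E)))
  rw [integral_prod _ (integrable_polar μ hF)] at h2
  simp only [fun s : sphere (0 : E) 1 =>
    integral_volumeIoiPow (finrank ℝ E - 1) fun ρ => F (ρ • (s : E))] at h2
  rw [h1, ← h2]
  refine integral_congr_ae (ae_of_all _ fun x => ?_)
  have hx : ‖(x : E)‖ ≠ 0 := norm_ne_zero_iff.2 x.2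
  simp [smul_smul, hx]

/-- The unit ball in polar coordinates. -/
theorem integral_closedBall_eq_integral_toSphere {G : E → ℝ} (hG : Continuous G) :
    ∫ x in closedBall (0 : E) 1, G x ∂μ = ∫ s : sphere (0 : E) 1,
      (∫ ρ in (0 : ℝ)..1, ρ ^ (finrank ℝ E - 1) * G (ρ • (s : E))) ∂μ.toSphere := by
  have hi : Integrable ((closedBall (0 : E) 1).indicator G) μ :=
    (integrable_indicator_iff measurableSet_closedBall).2
      (hG.continuousOn.integrableOn_compact (isCompact_closedBall _ _))
  rw [← integral_indicator measurableSet_closedBall, integral_eq_integral_toSphere μ hi]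
  refine integral_congr_ae (ae_of_all _ fun s => ?_)
  simp only
  have hs : ‖(s : E)‖ = 1 := by simp
  rw [intervalIntegral.integral_of_le zero_le_one, ← integral_indicator measurableSet_Ioi,
    ← integral_indicator measurableSet_Ioc]
  congr 1
  funext ρ
  by_cases h0 : 0 < ρ
  · by_cases h1 : ρ ≤ 1 <;> simp [indicator, h0, h1, norm_smul, hs, abs_of_pos h0]
  · simp [indicator, h0]

end Sphere

/-! ### Contracting the unit ball towards a point. -/

section Contraction

variable {E : Type*} [NormedAddCommGroup E] [NormedSpace ℝ E] [MeasurableSpace E] [BorelSpace E]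
  [FiniteDimensional ℝ E] (μ : Measure E) [μ.IsAddHaarMeasure]

theorem setIntegral_closedBall_contraction (G : E → ℝ) (y : E) {ε : ℝ} (hε : ε < 1) :
    ∫ x in closedBall (ε • y) (1 - ε), G x ∂μ =
      (1 - ε) ^ finrank ℝ E * ∫ x in closedBall (0 : E) 1, G ((1 - ε) • x + ε • y) ∂μ := by
  have h0 : 0 < 1 - ε := by linarith
  have h1 := Measure.setIntegral_comp_smul μ (fun x => G (x + ε • y)) (closedBall (0 : E) 1) h0.ne'
  rw [h1, _root_.smul_closedBall _ _ zero_le_one]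
  have h2 := (measurePreserving_add_right μ (ε • y)).setIntegral_preimage_emb
    (measurableEmbedding_addRight _) G (closedBall (ε • y) (1 - ε))
  rw [← h2, abs_of_pos (by positivity), smul_eq_mul, ← mul_assoc,
    mul_inv_cancel₀ (by positivity), one_mul]
  congr 2
  ext x
  simp [abs_of_pos h0]

/-- Every point of the contracted ball is `(1-ε)x + εy` with `x` in the unit ball, so convexity
applies pointwise after the change of variables. Both `x` and `y` lie in `W`. -/
theorem setIntegral_closedBall_le_of_convexOn {G : E → ℝ} (hG : Continuous G) {W : Set E}
    (hGW : ConvexOn ℝ W G) (hW : closedBall 0 1 ⊆ W) {y : E} (hy : y ∈ W) {ε : ℝ} (h0 : 0 ≤ ε)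
    (h1 : ε < 1) :
    ∫ x in closedBall (ε • y) (1 - ε), G x ∂μ ≤ (1 - ε) ^ finrank ℝ E *
      ((1 - ε) * ∫ x in closedBall (0 : E) 1, G x ∂μ + ε * G y * μ.real (closedBall 0 1)) := by
  rw [setIntegral_closedBall_contraction μ G y h1]
  refine mul_le_mul_of_nonneg_left ?_ (by have : 0 < 1 - ε := by linarith
                                          positivity)
  have hint : ∀ F : E → ℝ, Continuous F → IntegrableOn F (closedBall (0 : E) 1) μ := fun F hF =>
    hF.continuousOn.integrableOn_compact (isCompact_closedBall _ _)
  calc ∫ x in closedBall (0 : E) 1, G ((1 - ε) • x + ε • y) ∂μ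
      ≤ ∫ x in closedBall (0 : E) 1, ((1 - ε) * G x + ε * G y) ∂μ := by
        refine setIntegral_mono_on (hint _ (by fun_prop)) (hint _ (by fun_prop))
          measurableSet_closedBall fun x hx => ?_
        exact hGW.2 (hW hx) hy (by linarith) h0 (by ring)
    _ = _ := by
        rw [integral_add (hint _ (by fun_prop)) (hint _ (by fun_prop)), integral_const_mul,
          setIntegral_const, smul_eq_mul]
        ring

end Contraction

/-! ### The shell between the sphere and the contracted ball. -/

section Shell

variable {E : Type*} [NormedAddCommGroup E] [InnerProductSpace ℝ E]

/-- In direction `s` the contracted sphere is at distance `1 + ε(⟨s,y⟩ - 1) + O(ε²)` from the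
origin. The constant `2‖y‖² + 2` pays for the second-order term. -/
theorem smul_mem_closedBall_contraction {s y : E} (hs : ‖s‖ = 1) {ε ρ : ℝ} (hε : 0 ≤ ε)
    (hε' : ε * (2 * ‖y‖ ^ 2 + 2) ≤ 1 - ε) (hε2 : ε ≤ 1 / 2) (hρ : 0 ≤ ρ)
    (hρ' : ρ ≤ 1 + ε * (inner ℝ s y - 1 - (2 * ‖y‖ ^ 2 + 2) * ε)) :
    ρ • s ∈ closedBall (ε • y) (1 - ε) := by
  set c := inner ℝ s y with hc
  set N := ‖y‖ with hN
  set K := 2 * N ^ 2 + 2 with hK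
  have hN0 : 0 ≤ N := norm_nonneg y
  have hN2 : ε * N ≤ 1 - ε := by
    refine le_trans (mul_le_mul_of_nonneg_left ?_ hε) hε'
    nlinarith [sq_nonneg (N - 1)]
  rw [mem_closedBall, dist_eq_norm]
  refine abs_le_of_sq_le_sq' ?_ (by linarith) |>.2
  have hsq : ‖ρ • s - ε • y‖ ^ 2 = ρ ^ 2 - 2 * ρ * ε * c + ε ^ 2 * N ^ 2 := by
    rw [norm_sub_sq_real, norm_smul, norm_smul, real_inner_smul_left, real_inner_smul_right, hs,
      mul_pow, mul_pow, Real.norm_eq_abs, Real.norm_eq_abs, sq_abs, sq_abs]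
    ring
  rw [hsq]
  have hεN : ε ^ 2 * N ^ 2 ≤ (1 - ε) ^ 2 := by
    rw [← mul_pow]; exact pow_le_pow_left₀ (by positivity) hN2 2
  -- The squared distance is `ρ(ρ - 2εc) + ε²N²`. Its first term is nonpositive up to `2εc` and
  -- increasing from there on, so only the endpoint `q` needs testing.
  rcases le_total ρ (2 * ε * c) with h | h
  · nlinarith [mul_nonneg hρ (sub_nonneg.2 h)]
  · set q := 1 + ε * (c - 1 - K * ε) with hq
    have h1 : ρ * (ρ - 2 * ε * c) ≤ q * (q - 2 * ε * c) :=
      mul_le_mul hρ' (by linarith) (by linarith) (by linarith)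
    have h2 : q * (q - 2 * ε * c) + ε ^ 2 * N ^ 2 =
        (1 - ε) ^ 2 - ε ^ 2 * (2 * (1 - ε) * K - K * (ε * (K * ε)) - N ^ 2 + c ^ 2) := by
      rw [hq]; ring
    have hK0 : 0 ≤ K := by positivity
    have h3 : K * (ε * (K * ε)) ≤ K * (1 - ε) := by
      refine mul_le_mul_of_nonneg_left ?_ hK0
      have : ε * (K * ε) = (ε * K) * ε := by ring
      rw [this]
      nlinarith [mul_nonneg hε hK0]
    have h4 : 0 ≤ 2 * (1 - ε) * K - K * (ε * (K * ε)) - N ^ 2 + c ^ 2 := by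
      nlinarith [sq_nonneg c]
    nlinarith [mul_nonneg (sq_nonneg ε) h4]

/-- The contribution to `∫ G` of the shell between the unit sphere and the boundary of a
contracted ball, divided by `ε`, in the direction `s`. -/
def shellIntegral (G : E → ℝ) (y : E) (ε : ℝ) (s : E) : ℝ :=
  ∫ τ in (0 : ℝ)..inner ℝ s y - 1 - (2 * ‖y‖ ^ 2 + 2) * ε,
    (1 + ε * τ) ^ (finrank ℝ E - 1) * G ((1 + ε * τ) • s)

/-- The variable `τ = (ρ - 1)/ε` removes the division by `ε`, so the expression extends continuously
to `ε = 0`, where it is the flux density. -/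
theorem continuous_shellIntegral {G : E → ℝ} (hG : Continuous G) (y : E) :
    Continuous fun p : ℝ × E => shellIntegral G y p.1 p.2 := by
  unfold shellIntegral
  refine intervalIntegral.continuous_parametric_intervalIntegral_of_continuous ?_ (by fun_prop)
  fun_prop

theorem shellIntegral_zero (G : E → ℝ) (y s : E) :
    shellIntegral G y 0 s = (inner ℝ s y - 1) * G s := by
  simp [shellIntegral]

theorem mul_shellIntegral (G : E → ℝ) (y : E) (ε : ℝ) (s : E) :
    ε * shellIntegral G y ε s =
      ∫ ρ in (1 : ℝ)..1 + ε * (inner ℝ s y - 1 - (2 * ‖y‖ ^ 2 + 2) * ε),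
        ρ ^ (finrank ℝ E - 1) * G (ρ • s) := by
  have := intervalIntegral.smul_integral_comp_add_mul
    (a := 0) (b := inner ℝ s y - 1 - (2 * ‖y‖ ^ 2 + 2) * ε)
    (fun ρ => ρ ^ (finrank ℝ E - 1) * G (ρ • s)) ε 1
  simpa [shellIntegral] using this

end Shell

/-! ### First-order comparison of the two bounds. -/

section Flux

variable {E : Type*} [NormedAddCommGroup E] [InnerProductSpace ℝ E] [MeasurableSpace E]
  [BorelSpace E] [FiniteDimensional ℝ E] (μ : Measure E) [μ.IsAddHaarMeasure]

theorem integral_inner_toSphere (y : E) :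
    ∫ s : sphere (0 : E) 1, inner ℝ (s : E) y ∂μ.toSphere = 0 := by
  have := integral_toSphere_comp_neg μ fun s => inner ℝ (s : E) y
  simp only [coe_neg_sphere, inner_neg_left, integral_neg] at this
  linarith

theorem Continuous.integrable_toSphere {φ : sphere (0 : E) 1 → ℝ} (hφ : Continuous φ) :
    Integrable φ μ.toSphere :=
  hφ.integrable_of_hasCompactSupport (HasCompactSupport.of_compactSpace φ)

variable [Nontrivial E]

/-- Each ray meets the contracted ball at least in `(0, q]`, and nonnegativity of `G` allows the
rest to be dropped. The shell is signed: where `q < 1` it removes part of the unit ball. -/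
theorem setIntegral_closedBall_add_shell_le {G : E → ℝ} (hG : Continuous G) {y : E}
    (hG0 : ∀ x ∈ closedBall (0 : E) (1 + ‖y‖), 0 ≤ G x) {ε : ℝ} (hε : 0 < ε)
    (hε' : ε * (2 * ‖y‖ ^ 2 + 2) ≤ 1 - ε) (hε2 : ε ≤ 1 / 2) :
    ∫ x in closedBall (0 : E) 1, G x ∂μ
        + ε * ∫ s : sphere (0 : E) 1, shellIntegral G y ε s ∂μ.toSphere ≤
      ∫ x in closedBall (ε • y) (1 - ε), G x ∂μ := by
  have hsub : closedBall (ε • y) (1 - ε) ⊆ closedBall (0 : E) (1 + ‖y‖) := by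
    refine closedBall_subset_closedBall' ?_
    rw [dist_zero_right, norm_smul, Real.norm_of_nonneg hε.le]
    nlinarith [norm_nonneg y]
  have hi : Integrable ((closedBall (ε • y) (1 - ε)).indicator G) μ :=
    (integrable_indicator_iff measurableSet_closedBall).2
      (hG.continuousOn.integrableOn_compact (isCompact_closedBall _ _))
  have hc1 : Continuous fun s : sphere (0 : E) 1 =>
      ∫ ρ in (0 : ℝ)..1, ρ ^ (finrank ℝ E - 1) * G (ρ • (s : E)) :=
    intervalIntegral.continuous_parametric_intervalIntegral_of_continuous' (by fun_prop) _ _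
  have hc2 : Continuous fun s : sphere (0 : E) 1 => shellIntegral G y ε s :=
    (continuous_shellIntegral hG y).comp (by fun_prop : Continuous fun s : sphere (0 : E) 1 =>
      (ε, (s : E)))
  have hint : ∀ φ : sphere (0 : E) 1 → ℝ, Continuous φ → Integrable φ μ.toSphere := fun φ hφ =>
    hφ.integrable_of_hasCompactSupport (HasCompactSupport.of_compactSpace φ)
  rw [← integral_indicator measurableSet_closedBall (f := G) (s := closedBall (ε • y) (1 - ε)),
    integral_eq_integral_toSphere μ hi, integral_closedBall_eq_integral_toSphere μ hG,
    ← integral_const_mul, ← integral_add (hint _ hc1) ((hint _ hc2).const_mul ε)]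
  refine integral_mono ((hint _ hc1).add ((hint _ hc2).const_mul ε))
    (integrable_integral_toSphere μ hi) fun s => ?_
  have hs : ‖(s : E)‖ = 1 := by simp
  simp only [mul_shellIntegral]
  set q := 1 + ε * (inner ℝ (s : E) y - 1 - (2 * ‖y‖ ^ 2 + 2) * ε) with hq
  have hφ : Continuous fun ρ : ℝ => ρ ^ (finrank ℝ E - 1) * G (ρ • (s : E)) := by fun_prop
  rw [intervalIntegral.integral_add_adjacent_intervals (hφ.intervalIntegrable _ _)
    (hφ.intervalIntegrable _ _)]
  have hq0 : 0 ≤ q := by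
    have h1 : -‖y‖ ≤ inner ℝ (s : E) y := by
      have := abs_real_inner_le_norm (s : E) y
      rw [hs, one_mul] at this
      exact (abs_le.1 this).1
    have h2 : ‖y‖ + 1 ≤ 2 * ‖y‖ ^ 2 + 2 := by nlinarith [sq_nonneg (‖y‖ - 1)]
    have h3 : ε * (4 * ‖y‖) ≤ ε * (2 * ‖y‖ ^ 2 + 2) :=
      mul_le_mul_of_nonneg_left (by nlinarith [sq_nonneg (‖y‖ - 1)]) hε.le
    have h4 : ε * (-‖y‖) ≤ ε * inner ℝ (s : E) y := mul_le_mul_of_nonneg_left h1 hε.le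
    have h5 : ε * (2 * ‖y‖ ^ 2 + 2) * ε ≤ (1 - ε) * ε := mul_le_mul_of_nonneg_right hε' hε.le
    nlinarith
  set D : Set ℝ := (fun ρ : ℝ => ρ • (s : E)) ⁻¹' closedBall (ε • y) (1 - ε) with hD
  have hDc : IsClosed D := isClosed_closedBall.preimage (by fun_prop)
  have hDb : D ⊆ closedBall (0 : ℝ) (1 + ‖y‖) := fun ρ hρ => by
    simpa [norm_smul, hs] using hsub hρ
  have hDi : IntegrableOn (fun ρ : ℝ => ρ ^ (finrank ℝ E - 1) * G (ρ • (s : E))) D :=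
    hφ.continuousOn.integrableOn_compact ((isCompact_closedBall _ _).of_isClosed_subset hDc hDb)
  have hR : ∫ ρ in Ioi (0 : ℝ), ρ ^ (finrank ℝ E - 1) *
      (closedBall (ε • y) (1 - ε)).indicator G (ρ • (s : E)) =
      ∫ ρ in Ioi 0 ∩ D, ρ ^ (finrank ℝ E - 1) * G (ρ • (s : E)) := by
    rw [← setIntegral_indicator hDc.measurableSet]
    refine setIntegral_congr_fun measurableSet_Ioi fun ρ _ => ?_
    by_cases h : ρ ∈ D
    · have h' : ρ • (s : E) ∈ closedBall (ε • y) (1 - ε) := h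
      simp only [indicator_of_mem h, indicator_of_mem h']
    · have h' : ρ • (s : E) ∉ closedBall (ε • y) (1 - ε) := h
      simp only [indicator_of_notMem h, indicator_of_notMem h', mul_zero]
  rw [hR, intervalIntegral.integral_of_le hq0]
  refine setIntegral_mono_set (hDi.mono_set inter_subset_right) ?_
    (Filter.Eventually.of_forall fun ρ hρ => ?_)
  · refine (ae_restrict_mem (measurableSet_Ioi.inter hDc.measurableSet)).mono fun ρ hρ => ?_
    exact mul_nonneg (pow_nonneg hρ.1.le _) (hG0 _ (hsub hρ.2))
  · exact ⟨hρ.1, smul_mem_closedBall_contraction hs hε.le hε' hε2 hρ.1.le hρ.2⟩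

/-- After division by `ε`, the ball integral has coefficient `(1 - (1-ε)^(n+1))/ε`, a geometric sum
tending to `n + 1`, while the shell integral tends to the flux. -/
theorem integral_sphere_le_of_convexOn_of_nonneg {G : E → ℝ} (hG : Continuous G) {W : Set E}
    (hGW : ConvexOn ℝ W G) (hW : closedBall 0 1 ⊆ W) {y : E} (hy : y ∈ W)
    (hG0 : ∀ x ∈ closedBall (0 : E) (1 + ‖y‖), 0 ≤ G x) :
    (finrank ℝ E + 1) * ∫ x in closedBall (0 : E) 1, G x ∂μ
        + ∫ s : sphere (0 : E) 1, (inner ℝ (s : E) y - 1) * G s ∂μ.toSphere ≤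
      G y * μ.real (closedBall 0 1) := by
  set I := ∫ x in closedBall (0 : E) 1, G x ∂μ
  set V := μ.real (closedBall (0 : E) 1)
  set n := finrank ℝ E
  set H : ℝ → ℝ := fun ε => ∫ s : sphere (0 : E) 1, shellIntegral G y ε s ∂μ.toSphere with hH
  have hHc : Continuous H := by
    have hc : Continuous fun p : ℝ × sphere (0 : E) 1 => shellIntegral G y p.1 p.2 :=
      (continuous_shellIntegral hG y).comp (by fun_prop : Continuous
        fun p : ℝ × sphere (0 : E) 1 => (p.1, (p.2 : E)))
    simpa using continuous_parametric_integral_of_continuous (μ := μ.toSphere)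
      (f := fun ε (s : sphere (0 : E) 1) => shellIntegral G y ε s) hc isCompact_univ
  have key : ∀ᶠ ε in nhdsWithin (0 : ℝ) (Ioi 0),
      (∑ i ∈ Finset.range (n + 1), (1 - ε) ^ i) * I + H ε ≤ (1 - ε) ^ n * (G y * V) := by
    have h1 : ∀ᶠ ε in nhds (0 : ℝ), ε * (2 * ‖y‖ ^ 2 + 2) + ε < 1 :=
      ContinuousAt.eventually_lt (by fun_prop) (by fun_prop) (by norm_num)
    have h2 : ∀ᶠ ε in nhds (0 : ℝ), ε < 1 / 2 :=
      ContinuousAt.eventually_lt (by fun_prop) (by fun_prop) (by norm_num)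
    filter_upwards [self_mem_nhdsWithin, h1.filter_mono nhdsWithin_le_nhds,
      h2.filter_mono nhdsWithin_le_nhds] with ε hε he1 he2
    have hε : 0 < ε := hε
    have hlow := setIntegral_closedBall_add_shell_le μ hG hG0 hε (by linarith) he2.le
    have hup := setIntegral_closedBall_le_of_convexOn μ hG hGW hW hy hε.le (by linarith)
    have hgeo := mul_neg_geom_sum (1 - ε) (n + 1)
    have := hlow.trans hup
    refine le_of_mul_le_mul_left ?_ hε
    have hp : (1 - ε) ^ (n + 1) = (1 - ε) ^ n * (1 - ε) := pow_succ _ _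
    have hgeo' : ε * (∑ i ∈ Finset.range (n + 1), (1 - ε) ^ i) = 1 - (1 - ε) ^ n * (1 - ε) := by
      rw [← hp, ← hgeo]; ring
    calc ε * ((∑ i ∈ Finset.range (n + 1), (1 - ε) ^ i) * I + H ε)
        = (1 - (1 - ε) ^ n * (1 - ε)) * I + ε * H ε := by rw [← hgeo']; ring
      _ ≤ ε * ((1 - ε) ^ n * (G y * V)) := by linarith
  have hl : Continuous fun ε => (∑ i ∈ Finset.range (n + 1), (1 - ε) ^ i) * I + H ε := by fun_prop
  have hr : Continuous fun ε : ℝ => (1 - ε) ^ n * (G y * V) := by fun_prop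
  have := le_of_tendsto_of_tendsto (hl.continuousWithinAt (x := 0)) (hr.continuousWithinAt (x := 0))
    key
  simpa [hH, shellIntegral_zero] using this

theorem measureReal_closedBall_one : μ.real (closedBall (0 : E) 1) = μ.real (ball (0 : E) 1) := by
  rw [measureReal_def, Measure.addHaar_closedBall_eq_addHaar_ball, measureReal_def]

/-- An integrated form of the subgradient inequality for the average of a convex function over
the unit ball. -/
theorem integral_sphere_le_of_convexOn {G : E → ℝ} (hG : Continuous G) {W : Set E}
    (hGW : ConvexOn ℝ W G) (hW : closedBall 0 1 ⊆ W) {y : E} (hy : y ∈ W) :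
    (finrank ℝ E + 1) * ∫ x in closedBall (0 : E) 1, G x ∂μ
        + ∫ s : sphere (0 : E) 1, (inner ℝ (s : E) y - 1) * G s ∂μ.toSphere ≤
      G y * μ.real (closedBall 0 1) := by
  -- Adding a constant `M` secures nonnegativity and shifts both sides equally: the ball contributes
  -- `(n+1)VM`, and the sphere, of area `nV`, takes back `nVM`.
  obtain ⟨M, hM⟩ := (isCompact_closedBall (0 : E) (1 + ‖y‖)).exists_bound_of_continuousOn
    hG.continuousOn
  have h := integral_sphere_le_of_convexOn_of_nonneg μ (G := fun x => G x + M) (by fun_prop)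
    (hGW.add_const M) hW hy fun x hx => by
      have := neg_abs_le (G x)
      have := hM x hx
      rw [Real.norm_eq_abs] at this
      linarith
  rw [integral_add (hG.continuousOn.integrableOn_compact (isCompact_closedBall _ _))
    (continuous_const.continuousOn.integrableOn_compact (isCompact_closedBall _ _)),
    setIntegral_const, smul_eq_mul] at h
  have h2 : ∫ s : sphere (0 : E) 1, (inner ℝ (s : E) y - 1) * (G s + M) ∂μ.toSphere =
      ∫ s : sphere (0 : E) 1, (inner ℝ (s : E) y - 1) * G s ∂μ.toSphere
        - finrank ℝ E * μ.real (closedBall (0 : E) 1) * M := by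
    have e : ∀ s : sphere (0 : E) 1, (inner ℝ (s : E) y - 1) * (G s + M) =
      (inner ℝ (s : E) y - 1) * G s + (inner ℝ (s : E) y * M - M) := fun s => by ring
    simp only [e]
    rw [integral_add, integral_sub, integral_mul_const, integral_inner_toSphere, integral_const,
      Measure.toSphere_real_apply_univ, measureReal_closedBall_one, smul_eq_mul]
    · ring
    all_goals exact Continuous.integrable_toSphere μ (by fun_prop)
  rw [h2] at h
  linarith

end Flux

/-! ### From ball averages to sphere averages. -/

section Smoothing

variable {E : Type*} [NormedAddCommGroup E] [InnerProductSpace ℝ E] [MeasurableSpace E]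
  [BorelSpace E] [FiniteDimensional ℝ E] (μ : Measure E) [μ.IsAddHaarMeasure] [Nontrivial E]

theorem integral_pow_mul_gap (m : ℕ) (a b κ : ℝ) :
    ∫ ρ in (0 : ℝ)..1, ρ ^ m * ((1 + ρ) / 2 * a + (1 - ρ) / 2 * b - κ * (1 - ρ ^ 2)) =
      (1 / (m + 1) + 1 / (m + 2)) / 2 * a + (1 / (m + 1) - 1 / (m + 2)) / 2 * b
        - κ * (1 / (m + 1) - 1 / (m + 3)) := by
  have e : ∀ ρ : ℝ, ρ ^ m * ((1 + ρ) / 2 * a + (1 - ρ) / 2 * b - κ * (1 - ρ ^ 2)) =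
      (a / 2 + b / 2 - κ) * ρ ^ m + ((a / 2 - b / 2) * ρ ^ (m + 1) + κ * ρ ^ (m + 2)) := fun ρ => by
    ring
  simp only [e]
  rw [intervalIntegral.integral_add, intervalIntegral.integral_add,
    intervalIntegral.integral_const_mul, intervalIntegral.integral_const_mul,
    intervalIntegral.integral_const_mul, integral_pow, integral_pow, integral_pow]
  · push_cast
    simp only [one_pow, zero_pow (Nat.succ_ne_zero _), sub_zero, add_assoc]
    norm_num
    ring
  all_goals exact Continuous.intervalIntegrable (by fun_prop) _ _

/-- A lower bound on the average over the unit ball in terms of the average over the sphere. -/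
theorem integral_sphere_le_integral_ball {G : E → ℝ} (hG : Continuous G) {κ : ℝ}
    (hκ : ∀ s : E, ‖s‖ = 1 → ∀ ρ ∈ Icc (0 : ℝ) 1,
      (1 + ρ) / 2 * G s + (1 - ρ) / 2 * G (-s) ≤ G (ρ • s) + κ * (1 - ρ ^ 2)) :
    (∫ s : sphere (0 : E) 1, G s ∂μ.toSphere) / finrank ℝ E
        - κ * (1 / finrank ℝ E - 1 / (finrank ℝ E + 2)) * μ.toSphere.real univ ≤
      ∫ x in closedBall (0 : E) 1, G x ∂μ := by
  obtain ⟨m, hm⟩ : ∃ m, finrank ℝ E = m + 1 := Nat.exists_eq_succ_of_ne_zero finrank_pos.ne'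
  have hint : ∀ φ : E → ℝ, Continuous φ →
      Integrable (fun s : sphere (0 : E) 1 => φ s) μ.toSphere := fun φ hφ =>
    Continuous.integrable_toSphere μ (by fun_prop)
  rw [integral_closedBall_eq_integral_toSphere μ hG, hm, Nat.add_sub_cancel]
  -- The chord inequality is integrated against `ρ^m` along each ray. By antipodal symmetry the
  -- coefficients of `G s` and `G (-s)` then add up to `1/(m+1)`.
  have h1 : ∫ s : sphere (0 : E) 1, ((1 / (m + 1) + 1 / (m + 2)) / 2 * G s
        + (1 / (m + 1) - 1 / (m + 2)) / 2 * G (-s) - κ * (1 / (m + 1) - 1 / (m + 3))) ∂μ.toSphere ≤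
      ∫ s : sphere (0 : E) 1, (∫ ρ in (0 : ℝ)..1, ρ ^ m * G (ρ • (s : E))) ∂μ.toSphere := by
    refine integral_mono (hint (fun s => (1 / (m + 1) + 1 / (m + 2)) / 2 * G s
        + (1 / (m + 1) - 1 / (m + 2)) / 2 * G (-s) - κ * (1 / (m + 1) - 1 / (m + 3)))
        (by fun_prop)) (hint (fun s => ∫ ρ in (0 : ℝ)..1, ρ ^ m * G (ρ • s)) ?_) fun s => ?_
    · exact intervalIntegral.continuous_parametric_intervalIntegral_of_continuous'
        (by fun_prop) _ _
    · simp only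
      rw [← integral_pow_mul_gap]
      refine intervalIntegral.integral_mono_on zero_le_one
        (Continuous.intervalIntegrable (by fun_prop) _ _)
        (Continuous.intervalIntegrable (by fun_prop) _ _) fun ρ hρ => ?_
      refine mul_le_mul_of_nonneg_left ?_ (pow_nonneg hρ.1 _)
      linarith [hκ s (by simp) ρ hρ]
  refine le_trans (le_of_eq ?_) h1
  have hneg : ∫ s : sphere (0 : E) 1, G (-s) ∂μ.toSphere =
      ∫ s : sphere (0 : E) 1, G s ∂μ.toSphere :=
    integral_toSphere_comp_neg μ fun s => G s
  rw [integral_sub, integral_add, integral_const_mul, integral_const_mul, hneg, integral_const,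
    smul_eq_mul]
  · push_cast; ring
  · exact hint (fun s => _ * G s) (by fun_prop)
  · exact hint (fun s => _ * G (-s)) (by fun_prop)
  · exact hint (fun s => _ * G s + _ * G (-s)) (by fun_prop)
  · exact integrable_const _

/-- The one-point gradient estimate of a convex function is, up to the error `2 κ`, a subgradient
on average. -/
theorem average_sphere_le_of_convexOn {G : E → ℝ} (hG : Continuous G) {W : Set E}
    (hGW : ConvexOn ℝ W G) (hW : closedBall 0 1 ⊆ W) {y : E} (hy : y ∈ W) {κ : ℝ} (hκ0 : 0 ≤ κ)
    (hκ : ∀ s : E, ‖s‖ = 1 → ∀ ρ ∈ Icc (0 : ℝ) 1,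
      (1 + ρ) / 2 * G s + (1 - ρ) / 2 * G (-s) ≤ G (ρ • s) + κ * (1 - ρ ^ 2)) :
    (μ.toSphere.real univ)⁻¹ * ∫ s : sphere (0 : E) 1, G s ∂μ.toSphere
        + finrank ℝ E * ((μ.toSphere.real univ)⁻¹ *
          ∫ s : sphere (0 : E) 1, inner ℝ (s : E) y * G s ∂μ.toSphere) ≤ G y + 2 * κ := by
  have hA := integral_sphere_le_of_convexOn μ hG hGW hW hy
  have hB := integral_sphere_le_integral_ball μ hG hκ
  have hS := μ.toSphere_real_apply_univ
  rw [← measureReal_closedBall_one] at hS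
  have hV : 0 < μ.real (closedBall (0 : E) 1) := by
    rw [measureReal_def]
    exact ENNReal.toReal_pos (measure_closedBall_pos μ _ one_pos).ne' measure_closedBall_lt_top.ne
  have hn : (1 : ℝ) ≤ finrank ℝ E := by exact_mod_cast (finrank_pos : 0 < finrank ℝ E)
  set n : ℝ := (finrank ℝ E : ℝ)
  set V := μ.real (closedBall (0 : E) 1)
  set I := ∫ x in closedBall (0 : E) 1, G x ∂μ
  have hsplit : ∫ s : sphere (0 : E) 1, (inner ℝ (s : E) y - 1) * G s ∂μ.toSphere =
      ∫ s : sphere (0 : E) 1, inner ℝ (s : E) y * G s ∂μ.toSphere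
        - ∫ s : sphere (0 : E) 1, G s ∂μ.toSphere := by
    rw [← integral_sub]
    · simp only [sub_mul, one_mul]
    all_goals exact Continuous.integrable_toSphere μ (by fun_prop)
  rw [hsplit] at hA
  set P := ∫ s : sphere (0 : E) 1, inner ℝ (s : E) y * G s ∂μ.toSphere
  set Q := ∫ s : sphere (0 : E) 1, G s ∂μ.toSphere
  rw [hS] at hB ⊢
  have hn0 : 0 < n := by linarith
  have hB' : Q / n - κ * (2 / (n + 2)) * V ≤ I := by
    refine le_trans (le_of_eq ?_) hB
    field_simp
    ring
  have h1 : (n + 1) * (Q / n - κ * (2 / (n + 2)) * V) + (P - Q) ≤ G y * V :=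
    le_trans (by gcongr) hA
  have h2 : Q / n + P ≤ (G y + 2 * κ) * V := by
    have h3 : (n + 1) * (Q / n) = Q + Q / n := by field_simp
    -- The factor `n + 1` from the contraction is compensated by `2/(n+2)`, so the error is free of
    -- the dimension.
    have h4 : (n + 1) * (κ * (2 / (n + 2)) * V) ≤ 2 * κ * V := by
      have : (n + 1) * (2 / (n + 2)) ≤ 2 := by
        rw [mul_div_assoc', div_le_iff₀ (by linarith)]; linarith
      calc (n + 1) * (κ * (2 / (n + 2)) * V) = ((n + 1) * (2 / (n + 2))) * (κ * V) := by ring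
        _ ≤ 2 * (κ * V) := by gcongr
        _ = _ := by ring
    nlinarith
  calc (n * V)⁻¹ * Q + n * ((n * V)⁻¹ * P) = (Q / n + P) / V := by field_simp
    _ ≤ G y + 2 * κ := by rwa [div_le_iff₀ hV]

end Smoothing

/-! ### Chord gaps of Lipschitz and smooth losses. -/

section Gap

variable {d : ℕ} {f : Vec d → ℝ} {W : Set (Vec d)} {x : Vec d} {r : ℝ}

/-- The endpoints are at distances `r(1-ρ)` and `r(1+ρ)` from the intermediate point. Weighted by
`(1+ρ)/2` and `(1-ρ)/2`, each contributes `Lr(1-ρ²)/2`. -/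
theorem gap_of_lipschitz {L : ℝ} (hL : ∀ x ∈ W, ∀ y ∈ W, |f y - f x| ≤ L * ‖y - x‖) (hr : 0 ≤ r)
    (hW : closedBall x r ⊆ W) {s : Vec d} (hs : ‖s‖ = 1) {ρ : ℝ} (hρ : ρ ∈ Icc (0 : ℝ) 1) :
    (1 + ρ) / 2 * f (x + r • s) + (1 - ρ) / 2 * f (x + r • -s) ≤
      f (x + r • ρ • s) + L * r * (1 - ρ ^ 2) := by
  obtain ⟨h0, h1⟩ := hρ
  have hm : ∀ t : ℝ, |t| ≤ 1 → x + r • t • s ∈ W := fun t ht => hW (by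
    rw [mem_closedBall, dist_eq_norm, add_sub_cancel_left, norm_smul, norm_smul, hs,
      Real.norm_of_nonneg hr, Real.norm_eq_abs, mul_one]
    exact mul_le_of_le_one_right hr ht)
  have hd : ∀ t : ℝ, |t| ≤ 1 → f (x + r • t • s) - f (x + r • ρ • s) ≤ L * (r * |t - ρ|) := by
    intro t ht
    have h := hL _ (hm ρ (by rwa [abs_of_nonneg h0])) _ (hm t ht)
    have e : (x + r • t • s) - (x + r • ρ • s) = (r * (t - ρ)) • s := by module
    rw [e, norm_smul, hs, mul_one, norm_mul, Real.norm_of_nonneg hr, Real.norm_eq_abs] at h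
    exact (le_abs_self _).trans h
  have ha := hd 1 (by simp)
  have hb := hd (-1) (by simp)
  rw [one_smul, abs_of_nonneg (by linarith)] at ha
  rw [neg_one_smul, abs_of_nonpos (by linarith)] at hb
  have ha' := mul_le_mul_of_nonneg_left ha (by linarith : 0 ≤ (1 + ρ) / 2)
  have hb' := mul_le_mul_of_nonneg_left hb (by linarith : 0 ≤ (1 - ρ) / 2)
  linarith

/-- The intermediate point is the barycenter of the endpoints, so first-order terms cancel. What
remains is `β/2` times the variance `r²(1-ρ²)` of the two-point distribution. -/
theorem gap_of_smooth {β : ℝ} (hβ : IsSmoothOver β f W) (hr : 0 ≤ r)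
    (hW : closedBall x r ⊆ W) {s : Vec d} (hs : ‖s‖ = 1) {ρ : ℝ} (hρ : ρ ∈ Icc (0 : ℝ) 1) :
    (1 + ρ) / 2 * f (x + r • s) + (1 - ρ) / 2 * f (x + r • -s) ≤
      f (x + r • ρ • s) + β * r ^ 2 / 2 * (1 - ρ ^ 2) := by
  obtain ⟨h0, h1⟩ := hρ
  have hm : ∀ t : ℝ, |t| ≤ 1 → x + r • t • s ∈ W := fun t ht => hW (by
    rw [mem_closedBall, dist_eq_norm, add_sub_cancel_left, norm_smul, norm_smul, hs,
      Real.norm_of_nonneg hr, Real.norm_eq_abs, mul_one]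
    exact mul_le_of_le_one_right hr ht)
  set D := fderivWithin ℝ f W (x + r • ρ • s) s
  have hd : ∀ t : ℝ, |t| ≤ 1 → f (x + r • t • s) ≤
      f (x + r • ρ • s) + r * (t - ρ) * D + β / 2 * (r * (t - ρ)) ^ 2 := by
    intro t ht
    have h := hβ.2 _ (hm ρ (by rwa [abs_of_nonneg h0])) _ (hm t ht)
    have e : (x + r • t • s) - (x + r • ρ • s) = (r * (t - ρ)) • s := by module
    rwa [norm_sub_rev, e, norm_smul, hs, mul_one, Real.norm_eq_abs, sq_abs, map_smul,
      smul_eq_mul] at h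
  have ha := hd 1 (by simp)
  have hb := hd (-1) (by simp)
  rw [one_smul] at ha
  rw [neg_one_smul] at hb
  have ha' := mul_le_mul_of_nonneg_left ha (by linarith : 0 ≤ (1 + ρ) / 2)
  have hb' := mul_le_mul_of_nonneg_left hb (by linarith : 0 ≤ (1 - ρ) / 2)
  refine (add_le_add ha' hb').trans (le_of_eq ?_)
  ring

end Gap

/-! ### The one-point gradient estimate. -/

section Estimate

variable {d : ℕ}

theorem integral_uniformSphere (φ : sphere (0 : Vec d) 1 → ℝ) :
    ∫ s, φ s ∂uniformSphere d = ((volume : Measure (Vec d)).toSphere.real univ)⁻¹ *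
      ∫ s, φ s ∂(volume : Measure (Vec d)).toSphere := by
  rw [uniformSphere, integral_smul_measure, ENNReal.toReal_inv, smul_eq_mul, measureReal_def]

variable [Nontrivial (Vec d)]

instance : IsProbabilityMeasure (uniformSphere d) where
  measure_univ := by
    rw [uniformSphere, Measure.smul_apply, smul_eq_mul]
    exact ENNReal.inv_mul_cancel (Measure.measure_univ_ne_zero.2 (Measure.toSphere_ne_zero _))
      (measure_ne_top _ _)

instance : (uniformSphere d).IsOpenPosMeasure :=
  (Measure.isOpenPosMeasure_smul (volume : Measure (Vec d)).toSphere
    (ENNReal.inv_ne_zero.2 (measure_ne_top _ _)))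

theorem _root_.Continuous.integrable_uniformSphere {φ : sphere (0 : Vec d) 1 → ℝ}
    (hφ : Continuous φ) : Integrable φ (uniformSphere d) :=
  hφ.integrable_of_hasCompactSupport (HasCompactSupport.of_compactSpace φ)

theorem integral_sub_estimate_le {f : Vec d → ℝ} {W : Set (Vec d)} (hf : ConvexOn ℝ W f) {L : ℝ}
    (hL0 : 0 ≤ L) (hL : ∀ x ∈ W, ∀ y ∈ W, |f y - f x| ≤ L * ‖y - x‖) {x y : Vec d} {r κ : ℝ}
    (hr : 0 < r) (hW : closedBall x r ⊆ W) (hy : y ∈ W) (hκ0 : 0 ≤ κ)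
    (hκ : ∀ s : Vec d, ‖s‖ = 1 → ∀ ρ ∈ Icc (0 : ℝ) 1,
      (1 + ρ) / 2 * f (x + r • s) + (1 - ρ) / 2 * f (x + r • -s) ≤
        f (x + r • ρ • s) + κ * (1 - ρ ^ 2)) :
    ∫ s : sphere (0 : Vec d) 1, (f (x + r • (s : Vec d))
        - inner ℝ (x - y) ((d / r * f (x + r • (s : Vec d))) • (s : Vec d))) ∂uniformSphere d ≤
      f y + 2 * κ := by
  -- The integral inequalities ask for a function continuous on the whole space. The Lipschitz
  -- extension is one, and its values at the center ball and at `y` are those of `f`.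
  obtain ⟨F, hFL, hF⟩ := LipschitzOnWith.extend_real (f := f) (s := W) (K := L.toNNReal)
    (LipschitzOnWith.of_dist_le_mul fun a ha b hb => by
      rw [Real.dist_eq, dist_eq_norm, Real.coe_toNNReal _ hL0]
      exact hL b hb a ha)
  have hFc : Continuous F := hFL.continuous
  set G : Vec d → ℝ := fun p => F (x + r • p) with hG
  have hGc : Continuous G := by fun_prop
  set T : Vec d →ᵃ[ℝ] Vec d := r • AffineMap.id ℝ (Vec d) + AffineMap.const ℝ (Vec d) x with hT
  have hTa : ∀ p, T p = x + r • p := fun p => by simp [hT, add_comm]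
  have hball : ∀ p : Vec d, ‖p‖ ≤ 1 → x + r • p ∈ W := fun p hp => hW (by
    rw [mem_closedBall, dist_eq_norm, add_sub_cancel_left, norm_smul, Real.norm_of_nonneg hr.le]
    exact mul_le_of_le_one_right hr.le hp)
  have hGf : ∀ p : Vec d, ‖p‖ ≤ 1 → G p = f (x + r • p) := fun p hp => (hF (hball p hp)).symm
  have hGW : ConvexOn ℝ (T ⁻¹' W) G := by
    have := (hf.congr hF).comp_affineMap T
    refine this.congr fun p _ => ?_
    simp only [Function.comp_apply, hTa, hG]
  have hyT : x + r • (r⁻¹ • (y - x)) = y := by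
    rw [smul_smul, mul_inv_cancel₀ hr.ne', one_smul, add_sub_cancel]
  have key := average_sphere_le_of_convexOn volume hGc hGW (y := r⁻¹ • (y - x))
    (fun p hp => by
      rw [mem_preimage, hTa]; exact hball p (by simpa using hp))
    (by rw [mem_preimage, hTa, hyT]; exact hy) hκ0 (fun s hs ρ hρ => by
      rw [hGf s hs.le, hGf (-s) (by rw [norm_neg, hs]), hGf (ρ • s) (by
        rw [norm_smul, hs, mul_one, Real.norm_of_nonneg hρ.1]; exact hρ.2)]
      exact hκ s hs ρ hρ)
  rw [← integral_uniformSphere fun s : sphere (0 : Vec d) 1 => G s,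
    ← integral_uniformSphere fun s : sphere (0 : Vec d) 1 => inner ℝ (s : Vec d) (r⁻¹ • (y - x)) * G s,
    ← integral_const_mul, ← integral_add (Continuous.integrable_uniformSphere (by fun_prop))
      (Continuous.integrable_uniformSphere (by fun_prop))] at key
  have hGy : G (r⁻¹ • (y - x)) = f y := by
    simp only [hG, hyT]; exact (hF hy).symm
  rw [hGy] at key
  refine le_trans (le_of_eq (integral_congr_ae (ae_of_all _ fun s => ?_))) key
  simp only
  rw [hGf s (by simp), finrank_euclideanSpace_fin, real_inner_smul_right, real_inner_smul_right,
    real_inner_comm, inner_sub_right, inner_sub_right]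
  ring

/-- The possible plays fill the sphere of radius `v δ` about `v z`, whose convex hull is the closed
ball. -/
theorem closedBall_subset_of_point_mem {A : Input d} {v : ℝ} (hv : 0 ≤ v * A.δ) {z : Vec d}
    {W : Set (Vec d)} (hW : Convex ℝ W)
    (h : ∀ s : sphere (0 : Vec d) 1, A.point v z s ∈ W) : closedBall (v • z) (v * A.δ) ⊆ W := by
  rw [← convexHull_sphere_eq_closedBall _ hv]
  refine convexHull_min (fun p hp => ?_) hW
  rw [mem_sphere, dist_eq_norm] at hp
  rcases hv.eq_or_lt with h0 | h0
  · obtain ⟨s, hs⟩ := (NormedSpace.sphere_nonempty (x := (0 : Vec d))).2 zero_le_one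
    have := h ⟨s, hs⟩
    rw [← h0, norm_eq_zero, sub_eq_zero] at hp
    rwa [Input.point, smul_add, smul_smul, ← h0, zero_smul, add_zero, ← hp] at this
  · have := h ⟨(v * A.δ)⁻¹ • (p - v • z), by
      rw [mem_sphere_zero_iff_norm, norm_smul, hp, norm_inv, Real.norm_of_nonneg hv,
        inv_mul_cancel₀ h0.ne']⟩
    rwa [Input.point, smul_add, smul_smul, smul_smul, mul_inv_cancel₀ h0.ne', one_smul,
      add_sub_cancel] at this

/-- The regret of one round in expectation over its sample, in terms of the gradient estimate. -/
theorem integral_point_sub_estimate_le {A : Input d} {f : Vec d → ℝ} {W : Set (Vec d)}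
    (hf : ConvexOn ℝ W f) {L : ℝ} (hL0 : 0 ≤ L)
    (hL : ∀ x ∈ W, ∀ y ∈ W, |f y - f x| ≤ L * ‖y - x‖) {z y : Vec d} {v κ : ℝ}
    (hv : 0 < v * A.δ) (hW : ∀ s : sphere (0 : Vec d) 1, A.point v z s ∈ W) (hy : y ∈ W)
    (hκ0 : 0 ≤ κ)
    (hκ : closedBall (v • z) (v * A.δ) ⊆ W → ∀ s : Vec d, ‖s‖ = 1 → ∀ ρ ∈ Icc (0 : ℝ) 1,
      (1 + ρ) / 2 * f (v • z + (v * A.δ) • s) + (1 - ρ) / 2 * f (v • z + (v * A.δ) • -s) ≤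
        f (v • z + (v * A.δ) • ρ • s) + κ * (1 - ρ ^ 2)) :
    ∫ s : sphere (0 : Vec d) 1, (f (A.point v z s)
        - inner ℝ (v • z - y) (A.estimate f v z s)) ∂uniformSphere d ≤ f y + 2 * κ := by
  have hb := closedBall_subset_of_point_mem hv.le hf.1 hW
  have := integral_sub_estimate_le hf hL0 hL hv hb hy hκ0 (hκ hb)
  simpa only [Input.estimate, Input.point, smul_add, smul_smul] using this

end Estimate

/-! ### Boundedness of the scale learner. -/

section Scaling

variable {V : ScalingAlg} {l : Set ℝ} {T : ℕ} {LV C : ℝ} {k : ℕ}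

theorem ScalingAlg.run_congr (V : ScalingAlg) {g g' : ℕ → ℝ} {t : ℕ} (h : ∀ i < t, g i = g' i) :
    V.run g t = V.run g' t := by
  unfold ScalingAlg.run
  congr 1
  funext i
  exact h i i.2

/-- The regret guarantee forces the plays to be bounded, even if the segment is not. -/
theorem ImplementsScaling.exists_run_le (h : ImplementsScaling V l T LV C k) (hl : l ⊆ Ioi 0)
    (hne : l.Nonempty) :
    ∃ M, ∀ g : ℕ → ℝ, (∀ t < T, |g t| ≤ LV) → ∀ t < T, V.run g t ≤ M := by
  obtain ⟨v, hv⟩ := hne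
  have hv0 : 0 < v := hl hv
  suffices H : ∀ n ≤ T, ∃ M, 0 ≤ M ∧ ∀ g : ℕ → ℝ, (∀ t < T, |g t| ≤ LV) → ∀ t < n,
      V.run g t ≤ M by
    obtain ⟨M, -, hM⟩ := H T le_rfl
    exact ⟨M, hM⟩
  intro n
  induction n with
  | zero => exact fun _ => ⟨0, le_rfl, fun _ _ t ht => absurd ht (Nat.not_lt_zero t)⟩
  | succ n ih =>
    intro hn
    obtain ⟨M, hM0, hM⟩ := ih (by omega)
    suffices hB : ∃ B, ∀ g : ℕ → ℝ, (∀ t < T, |g t| ≤ LV) → V.run g n ≤ B by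
      obtain ⟨B, hB⟩ := hB
      refine ⟨max M B, le_max_of_le_left hM0, fun g hg t ht => ?_⟩
      rcases Nat.lt_succ_iff_lt_or_eq.1 ht with ht | rfl
      · exact le_max_of_le_left (hM g hg t ht)
      · exact le_max_of_le_right (hB g hg)
    rcases le_or_gt LV 0 with hLV | hLV
    · refine ⟨V.run 0 n, fun g hg => (V.run_congr fun i hi => ?_).le⟩
      exact abs_nonpos_iff.1 ((hg i (by omega)).trans hLV)
    · set R := C * logFactor k (T + |v| + LV) * (1 + |v| * LV * √(T : ℝ))
      refine ⟨v + R / LV + n * (M + v), fun g hg => ?_⟩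
      -- The past up to round `n` is kept, followed by one loss `LV` and then zeros. Plays up to
      -- round `n` are unchanged, and the regret bound on `g'` limits the play of round `n`, since
      -- earlier plays are bounded by induction.
      set g' : ℕ → ℝ := fun t => if t < n then g t else if t = n then LV else 0 with hg'
      have hlt : ∀ t, t < n → g' t = g t := fun t ht => if_pos ht
      have hn' : g' n = LV := by simp [hg']
      have hadm : ∀ t < T, |g' t| ≤ LV := fun t ht => by
        simp only [hg']
        split_ifs
        · exact hg t ht
        · exact (abs_of_pos hLV).le
        · simpa using hLV.le
      have hrun : ∀ t, t ≤ n → V.run g' t = V.run g t := fun t ht =>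
        V.run_congr fun i hi => hlt i (by omega)
      have hreg := h.regret_le g' hadm v hv
      have hsum : ∑ t ∈ Finset.range T, (V.run g' t - v) * g' t =
          ∑ t ∈ Finset.range (n + 1), (V.run g' t - v) * g' t := by
        symm
        refine Finset.sum_subset (Finset.range_subset_range.2 hn) fun t _ ht => ?_
        have : n < t := by simpa using ht
        have h0 : g' t = 0 := by simp [hg', this.not_gt, this.ne']
        rw [h0, mul_zero]
      rw [hsum, Finset.sum_range_succ, hn', hrun n le_rfl] at hreg
      have hlow : -(n * ((M + v) * LV)) ≤ ∑ t ∈ Finset.range n, (V.run g' t - v) * g' t := by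
        have e : -(n * ((M + v) * LV)) = ∑ _t ∈ Finset.range n, -((M + v) * LV) := by
          rw [Finset.sum_const, Finset.card_range, nsmul_eq_mul, mul_neg]
        rw [e]
        refine Finset.sum_le_sum fun t ht => ?_
        have ht : t < n := by simpa using ht
        suffices habs : |(V.run g' t - v) * g' t| ≤ (M + v) * LV from (abs_le.1 habs).1
        rw [abs_mul]
        refine mul_le_mul ?_ (hadm t (by omega)) (abs_nonneg _) (by positivity)
        have h1 : 0 < V.run g' t := hl (h.mem g' hadm t (by omega))
        have h2 := hM g' hadm t ht
        exact abs_le.2 ⟨by linarith, by linarith⟩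
      have h3 : (V.run g n - v) * LV ≤ R + n * ((M + v) * LV) := by linarith
      have h4 : V.run g n - v ≤ (R + n * ((M + v) * LV)) / LV := (le_div_iff₀ hLV).2 h3
      have h5 : (R + n * ((M + v) * LV)) / LV = R / LV + n * (M + v) := by field_simp
      linarith

end Scaling

/-! ### Projected gradient descent for the direction. -/

section Descent

variable {d : ℕ} {A : Input d}

theorem argminOn_spec {S : Set (Vec d)} (hS : IsCompact S) (hne : S.Nonempty) {f : Vec d → ℝ}
    (hf : Continuous f) : argminOn S f ∈ S ∧ IsMinOn f S (argminOn S f) :=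
  Classical.epsilon_spec (p := fun z => z ∈ S ∧ IsMinOn f S z)
    (hS.exists_isMinOn hne hf.continuousOn)

/-- A gradient step is a projection. -/
theorem Input.step_spec (hS : IsCompact ((1 - A.α) • A.Z)) (hne : ((1 - A.α) • A.Z).Nonempty)
    (hc : Convex ℝ ((1 - A.α) • A.Z)) (z g : Vec d) :
    A.step z g ∈ (1 - A.α) • A.Z ∧ ∀ y ∈ (1 - A.α) • A.Z,
      inner ℝ (z - (A.η / 2) • g - A.step z g) (y - A.step z g) ≤ 0 := by
  obtain ⟨hm, hmin⟩ := argminOn_spec hS hne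
    (f := fun y => A.η * inner ℝ y g + ‖z - y‖ ^ 2) (by fun_prop)
  change A.step z g ∈ _ at hm
  change IsMinOn _ _ (A.step z g) at hmin
  refine ⟨hm, (norm_eq_iInf_iff_real_inner_le_zero hc hm).1 ?_⟩
  -- Completing the square. The quadratic term has coefficient `1`, so the gradient step has length
  -- `η/2`.
  have hsq : ∀ y, ‖z - (A.η / 2) • g - y‖ ^ 2 =
      (A.η * inner ℝ y g + ‖z - y‖ ^ 2) + ((A.η / 2) ^ 2 * ‖g‖ ^ 2 - A.η * inner ℝ z g) := by
    intro y
    have e : z - (A.η / 2) • g - y = (z - y) - (A.η / 2) • g := by abel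
    rw [e, norm_sub_sq_real, real_inner_smul_right, inner_sub_left, norm_smul, mul_pow,
      Real.norm_eq_abs, sq_abs]
    ring
  have : Nonempty ((1 - A.α) • A.Z : Set (Vec d)) := hne.to_subtype
  refine le_antisymm (le_ciInf fun y => ?_)
    (ciInf_le ⟨0, by rintro _ ⟨y, rfl⟩; exact norm_nonneg _⟩
      (⟨A.step z g, hm⟩ : ((1 - A.α) • A.Z : Set (Vec d))))
  refine le_of_sq_le_sq ?_ (norm_nonneg _)
  rw [hsq, hsq]
  have := isMinOn_iff.1 hmin y y.2
  linarith

/-- Projection onto a convex set is nonexpansive. Continuity serves to make the directions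
measurable. -/
theorem Input.continuous_step (hS : IsCompact ((1 - A.α) • A.Z))
    (hne : ((1 - A.α) • A.Z).Nonempty) (hc : Convex ℝ ((1 - A.α) • A.Z)) :
    Continuous fun p : Vec d × Vec d => A.step p.1 p.2 := by
  have hLip : ∀ p q : Vec d × Vec d, ‖A.step p.1 p.2 - A.step q.1 q.2‖ ≤
      ‖(p.1 - (A.η / 2) • p.2) - (q.1 - (A.η / 2) • q.2)‖ := by
    intro p q
    obtain ⟨hp, hp'⟩ := A.step_spec hS hne hc p.1 p.2
    obtain ⟨hq, hq'⟩ := A.step_spec hS hne hc q.1 q.2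
    have h1 := hp' _ hq
    have h2 := hq' _ hp
    set a := p.1 - (A.η / 2) • p.2
    set b := q.1 - (A.η / 2) • q.2
    set x := A.step p.1 p.2
    set y := A.step q.1 q.2
    have h3 : ‖x - y‖ * ‖x - y‖ ≤ inner ℝ (a - b) (x - y) := by
      rw [← real_inner_self_eq_norm_mul_norm]
      simp only [inner_sub_left, inner_sub_right] at h1 h2 ⊢
      linarith
    have h4 := h3.trans (real_inner_le_norm _ _)
    rcases (norm_nonneg (x - y)).eq_or_lt with h0 | h0
    · rw [← h0]; exact norm_nonneg _
    · exact le_of_mul_le_mul_right h4 h0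
  rw [continuous_iff_continuousAt]
  intro q
  rw [ContinuousAt, tendsto_iff_norm_sub_tendsto_zero]
  refine squeeze_zero (fun _ => norm_nonneg _) (fun p => hLip p q) ?_
  have : Continuous fun p : Vec d × Vec d =>
    ‖(p.1 - (A.η / 2) • p.2) - (q.1 - (A.η / 2) • q.2)‖ := by fun_prop
  simpa using this.tendsto q

theorem Input.mul_inner_sub_le (hS : IsCompact ((1 - A.α) • A.Z)) (hc : Convex ℝ ((1 - A.α) • A.Z))
    {y : Vec d} (hy : y ∈ (1 - A.α) • A.Z) (z g : Vec d) :
    A.η * inner ℝ g (z - y) ≤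
      ‖z - y‖ ^ 2 - ‖A.step z g - y‖ ^ 2 + A.η ^ 2 / 4 * ‖g‖ ^ 2 := by
  obtain ⟨-, h⟩ := A.step_spec hS ⟨y, hy⟩ hc z g
  have h1 := h y hy
  set p := A.step z g
  have e1 : ‖z - (A.η / 2) • g - y‖ ^ 2 =
      ‖z - (A.η / 2) • g - p‖ ^ 2 - 2 * inner ℝ (z - (A.η / 2) • g - p) (y - p)
        + ‖p - y‖ ^ 2 := by
    have : z - (A.η / 2) • g - y = (z - (A.η / 2) • g - p) - (y - p) := by abel
    rw [this, norm_sub_sq_real, norm_sub_rev y p]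
  have e2 : ‖z - (A.η / 2) • g - y‖ ^ 2 =
      ‖z - y‖ ^ 2 - A.η * inner ℝ g (z - y) + A.η ^ 2 / 4 * ‖g‖ ^ 2 := by
    have : z - (A.η / 2) • g - y = (z - y) - (A.η / 2) • g := by abel
    rw [this, norm_sub_sq_real, real_inner_smul_right, real_inner_comm, norm_smul, mul_pow,
      Real.norm_eq_abs, sq_abs]
    ring
  nlinarith [sq_nonneg ‖z - (A.η / 2) • g - p‖]

theorem Input.norm_dir_le_one (hS : IsCompact ((1 - A.α) • A.Z))
    (hne : ((1 - A.α) • A.Z).Nonempty) (hc : Convex ℝ ((1 - A.α) • A.Z))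
    (h1 : (1 - A.α) • A.Z ⊆ closedBall 0 1) (f : ℕ → Vec d → ℝ) (s : ℕ → Vec d) (t : ℕ) :
    ‖A.dir f s t‖ ≤ 1 := by
  cases t with
  | zero => simp [Input.dir_zero]
  | succ t =>
    rw [Input.dir_succ]
    simpa using h1 (A.step_spec hS hne hc (A.dir f s t) (A.gradEst f s t)).1

theorem Input.sum_inner_dir_le (hS : IsCompact ((1 - A.α) • A.Z))
    (hc : Convex ℝ ((1 - A.α) • A.Z)) (h1 : (1 - A.α) • A.Z ⊆ closedBall 0 1)
    {y : Vec d} (hy : y ∈ (1 - A.α) • A.Z) (f : ℕ → Vec d → ℝ) (s : ℕ → Vec d) {T : ℕ} {B : ℝ}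
    (hB : ∀ t < T, ‖A.gradEst f s t‖ ≤ B) :
    A.η * ∑ t ∈ Finset.range T, inner ℝ (A.gradEst f s t) (A.dir f s t - y) ≤
      1 + A.η ^ 2 / 4 * (T * B ^ 2) := by
  have key : ∀ n ≤ T, A.η * ∑ t ∈ Finset.range n, inner ℝ (A.gradEst f s t) (A.dir f s t - y) ≤
      1 - ‖A.dir f s n - y‖ ^ 2 + A.η ^ 2 / 4 * (n * B ^ 2) := by
    intro n
    induction n with
    | zero =>
      intro _
      -- The starting direction `0` need not belong to `(1 - α) Z`; its distance to `y` is at most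
      -- `1` anyway.
      have : ‖y‖ ≤ 1 := by simpa using h1 hy
      have : ‖y‖ ^ 2 ≤ 1 := pow_le_one₀ (norm_nonneg _) this
      simpa [Input.dir_zero] using this
    | succ n ih =>
      intro hn
      have h := A.mul_inner_sub_le hS hc hy (A.dir f s n) (A.gradEst f s n)
      have hb : ‖A.gradEst f s n‖ ^ 2 ≤ B ^ 2 :=
        pow_le_pow_left₀ (norm_nonneg _) (hB n (by omega)) 2
      have hb' := mul_le_mul_of_nonneg_left hb (by positivity : 0 ≤ A.η ^ 2 / 4)
      rw [← Input.dir_succ] at h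
      rw [Finset.sum_range_succ, mul_add]
      have := ih (by omega)
      push_cast
      linarith
  have := key T le_rfl
  nlinarith [sq_nonneg ‖A.dir f s T - y‖]

end Descent

/-- The properties of the regularizer that the analysis uses: it is continuous, and convex and
differentiable at positive scales. -/
structure IsRegularizer (reg : ℝ → ℝ) : Prop where
  continuous : Continuous reg
  differentiableAt : ∀ v, 0 < v → DifferentiableAt ℝ reg v
  sub_le : ∀ a, 0 < a → ∀ b, 0 < b → reg a - reg b ≤ (a - b) * deriv reg a
  nonneg : ∀ v, 0 < v → 0 ≤ reg v

/-! ### Regret on the linearized losses along a path. -/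

section Pathwise

variable {d : ℕ} {A : Input d}

theorem IsRegularizer.deriv_surrogate (hreg : IsRegularizer A.reg) (z g : Vec d) {v : ℝ}
    (hv : 0 < v) : deriv (A.surrogate z g) v = inner ℝ z g + deriv A.reg v := by
  have h := ((hasDerivAt_id v).mul_const (inner ℝ z g)).add (hreg.differentiableAt v hv).hasDerivAt
  rw [one_mul] at h
  exact h.deriv

theorem Input.scale_mem {l : Set ℝ} {T : ℕ} {LV C : ℝ} {k : ℕ}
    (hA : ImplementsScaling A.V l T LV C k) {f : ℕ → Vec d → ℝ} {s : ℕ → Vec d}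
    (hfeed : ∀ t < T, |A.feedback f s t| ≤ LV) {t : ℕ} (ht : t < T) : A.scale f s t ∈ l := by
  rw [Input.scale_eq]
  exact hA.mem _ hfeed t ht

/-- The regret of the algorithm against the linearized losses, on every path. -/
theorem Input.sum_surrogate_le {l : Set ℝ} {T : ℕ} {LV C : ℝ} {k : ℕ}
    (hA : ImplementsScaling A.V l T LV C k) (hl : l ⊆ Ioi 0) (hreg : IsRegularizer A.reg)
    (hS : IsCompact ((1 - A.α) • A.Z)) (hc : Convex ℝ ((1 - A.α) • A.Z))
    (h1 : (1 - A.α) • A.Z ⊆ closedBall 0 1) (hη : 0 < A.η) {v : ℝ} (hv : v ∈ l)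
    {y : Vec d} (hy : y ∈ (1 - A.α) • A.Z) {f : ℕ → Vec d → ℝ} {s : ℕ → Vec d} {B : ℝ}
    (hB : ∀ t < T, ‖A.gradEst f s t‖ ≤ B) (hfeed : ∀ t < T, |A.feedback f s t| ≤ LV) :
    ∑ t ∈ Finset.range T, (inner ℝ (A.scale f s t • A.dir f s t - v • y) (A.gradEst f s t)
        + A.reg (A.scale f s t)) ≤
      C * logFactor k (T + |v| + LV) * (1 + |v| * LV * √(T : ℝ)) + T * A.reg v
        + v * (1 / A.η + A.η / 4 * (T * B ^ 2)) := by
  have hv0 : 0 < v := hl hv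
  have hscal := hA.regret_le (A.feedback f s) hfeed v hv
  have hdir := A.sum_inner_dir_le hS hc h1 hy f s hB
  have hdir' : ∑ t ∈ Finset.range T, inner ℝ (A.gradEst f s t) (A.dir f s t - y) ≤
      1 / A.η + A.η / 4 * (T * B ^ 2) := by
    refine le_of_mul_le_mul_left (hdir.trans (le_of_eq ?_)) hη
    field_simp
  -- The inner product is `(v_t - v)⟨z_t, ĝ_t⟩ + v⟨z_t - y, ĝ_t⟩`. Convexity gives `reg v_t - reg v
  -- ≤ (v_t - v) reg' v_t`, which completes the feedback in the first term.
  have hterm : ∀ t ∈ Finset.range T,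
      inner ℝ (A.scale f s t • A.dir f s t - v • y) (A.gradEst f s t) + A.reg (A.scale f s t) ≤
        (A.V.run (A.feedback f s) t - v) * A.feedback f s t + A.reg v
          + v * inner ℝ (A.gradEst f s t) (A.dir f s t - y) := by
    intro t ht
    have ht : t < T := Finset.mem_range.1 ht
    rw [← Input.scale_eq]
    have hpos : 0 < A.scale f s t := hl (A.scale_mem hA hfeed ht)
    have hf : A.feedback f s t = inner ℝ (A.dir f s t) (A.gradEst f s t)
        + deriv A.reg (A.scale f s t) := hreg.deriv_surrogate _ _ hpos
    have := hreg.sub_le _ hpos v hv0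
    rw [hf, inner_sub_left, inner_sub_right, real_inner_smul_left, real_inner_smul_left,
      real_inner_comm (A.dir f s t) (A.gradEst f s t), real_inner_comm y]
    linarith
  refine (Finset.sum_le_sum hterm).trans ?_
  rw [Finset.sum_add_distrib, Finset.sum_add_distrib, ← Finset.mul_sum, Finset.sum_const,
    Finset.card_range, nsmul_eq_mul]
  gcongr

theorem Input.norm_point_le {v : ℝ} (hv : 0 ≤ v) (hδ : 0 ≤ A.δ) (hδ1 : A.δ ≤ 1) {z s : Vec d}
    (hz : ‖z‖ ≤ 1) (hs : ‖s‖ = 1) : ‖A.point v z s‖ ≤ v * 2 := by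
  rw [Input.point, norm_smul, Real.norm_of_nonneg hv]
  refine mul_le_mul_of_nonneg_left ((norm_add_le _ _).trans ?_) hv
  rw [norm_smul, hs, Real.norm_of_nonneg hδ]
  linarith

/-- The factor `1/v` is compensated by `|f w| ≤ L‖w‖ ≤ 2Lv`, so the bound does not depend on the
scale. -/
theorem Input.norm_estimate_le {v L : ℝ} (hv : 0 < v) (hδ : 0 < A.δ) (hδ1 : A.δ ≤ 1)
    {z s : Vec d} (hz : ‖z‖ ≤ 1) (hs : ‖s‖ = 1) (hL : 0 ≤ L) {f : Vec d → ℝ}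
    (hf : |f (A.point v z s)| ≤ L * ‖A.point v z s‖) :
    ‖A.estimate f v z s‖ ≤ 2 * d * L / A.δ := by
  rw [Input.estimate, norm_smul, hs, mul_one, norm_mul, Real.norm_of_nonneg (by positivity),
    Real.norm_eq_abs]
  calc (d : ℝ) / (v * A.δ) * |f (A.point v z s)| ≤ d / (v * A.δ) * (L * (v * 2)) := by
        gcongr
        exact hf.trans (by gcongr; exact A.norm_point_le hv.le hδ.le hδ1 hz hs)
    _ = _ := by field_simp

end Pathwise

/-! ### Measurability, independence and adaptedness. -/

section Measurability

variable {d : ℕ} {A : Input d} {α : Type*} {m : MeasurableSpace α} {f : α → Vec d → ℝ}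
  {v : α → ℝ} {z s g : α → Vec d}

theorem Input.measurable_point (hv : Measurable v) (hz : Measurable z) (hs : Measurable s) :
    Measurable fun a => A.point (v a) (z a) (s a) :=
  hv.smul (hz.add (hs.const_smul A.δ : Measurable fun a => A.δ • s a))

theorem Input.measurable_apply_point (hf : Measurable fun p : α × Vec d => f p.1 p.2)
    (hv : Measurable v) (hz : Measurable z) (hs : Measurable s) :
    Measurable fun a => f a (A.point (v a) (z a) (s a)) :=
  hf.comp (measurable_id.prodMk (A.measurable_point hv hz hs))

theorem Input.measurable_estimate (hf : Measurable fun p : α × Vec d => f p.1 p.2)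
    (hv : Measurable v) (hz : Measurable z) (hs : Measurable s) :
    Measurable fun a => A.estimate (f a) (v a) (z a) (s a) :=
  ((measurable_const.div (hv.mul_const _)).mul (A.measurable_apply_point hf hv hz hs)).smul hs

theorem Input.measurable_deriv_surrogate (hreg : Continuous A.reg) (hv : Measurable v)
    (hz : Measurable z) (hg : Measurable g) :
    Measurable fun a => deriv (A.surrogate (z a) (g a)) (v a) := by
  have h := measurable_deriv_with_param (𝕜 := ℝ) (f := fun c v : ℝ => v * c + A.reg v)
    (by unfold Function.uncurry; fun_prop)
  exact h.comp ((hz.inner hg).prodMk hv)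

end Measurability

section Independence

variable {Ω Ω' S : Type*} {mΩ : MeasurableSpace Ω} {mΩ' : MeasurableSpace Ω'}
  {mS : MeasurableSpace S} {μ : Measure Ω} [IsProbabilityMeasure μ] {Y : Ω → Ω'} {X : Ω → S}

/-- Independence makes the joint law a product, so by Fubini an inequality may be checked with the
past frozen. -/
theorem _root_.ProbabilityTheory.IndepFun.integral_le (h : IndepFun Y X μ) (hY : Measurable Y)
    (hX : Measurable X) {Φ : Ω' × S → ℝ} (hΦ : Measurable Φ)
    (hint : Integrable (fun ω => Φ (Y ω, X ω)) μ) {ψ : Ω → ℝ} (hψ : Integrable ψ μ)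
    (hle : ∀ᵐ ω ∂μ, ∫ s, Φ (Y ω, s) ∂μ.map X ≤ ψ ω) : ∫ ω, Φ (Y ω, X ω) ∂μ ≤ ∫ ω, ψ ω ∂μ := by
  have hpX : IsProbabilityMeasure (μ.map X) := Measure.isProbabilityMeasure_map hX.aemeasurable
  have hpY : IsProbabilityMeasure (μ.map Y) := Measure.isProbabilityMeasure_map hY.aemeasurable
  have hmap := (indepFun_iff_map_prod_eq_prod_map_map hY.aemeasurable hX.aemeasurable).1 h
  have hΦi : Integrable Φ ((μ.map Y).prod (μ.map X)) := by
    rw [← hmap, integrable_map_measure hΦ.aestronglyMeasurable (hY.prodMk hX).aemeasurable]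
    exact hint
  have hi := hΦi.integral_prod_left
  rw [← integral_map (φ := fun ω => (Y ω, X ω)) (hY.prodMk hX).aemeasurable
    hΦ.aestronglyMeasurable, hmap, integral_prod _ hΦi,
    integral_map hY.aemeasurable hi.aestronglyMeasurable]
  exact integral_mono_ae (hi.comp_measurable hY) hψ hle

theorem _root_.ProbabilityTheory.IndepFun.ae_ae_of_ae (h : IndepFun Y X μ) (hY : Measurable Y)
    (hX : Measurable X) {P : Ω' × S → Prop} (hP : MeasurableSet {p | P p})
    (hae : ∀ᵐ ω ∂μ, P (Y ω, X ω)) : ∀ᵐ ω ∂μ, ∀ᵐ s ∂μ.map X, P (Y ω, s) := by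
  have hpX : IsProbabilityMeasure (μ.map X) := Measure.isProbabilityMeasure_map hX.aemeasurable
  have hpY : IsProbabilityMeasure (μ.map Y) := Measure.isProbabilityMeasure_map hY.aemeasurable
  have hmap := (indepFun_iff_map_prod_eq_prod_map_map hY.aemeasurable hX.aemeasurable).1 h
  have h2 : ∀ᵐ p ∂(μ.map Y).prod (μ.map X), P p := by
    rw [← hmap, ae_map_iff (hY.prodMk hX).aemeasurable hP]
    exact hae
  exact ae_of_ae_map hY.aemeasurable (Measure.ae_ae_of_ae_prod h2)

end Independence

section Adapted

variable {d : ℕ} {A : Input d}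

theorem ScalingAlg.measurable_run {α : Type*} {m : MeasurableSpace α} {V : ScalingAlg} {t : ℕ}
    (hV : Measurable (V t)) {g : α → ℕ → ℝ} (hg : ∀ i < t, Measurable fun a => g a i) :
    Measurable fun a => V.run (g a) t :=
  hV.comp (measurable_pi_lambda _ fun i => hg i i.2)

theorem Input.measurable_step {α : Type*} {m : MeasurableSpace α}
    (hstep : Continuous fun p : Vec d × Vec d => A.step p.1 p.2) {z g : α → Vec d}
    (hz : Measurable z) (hg : Measurable g) : Measurable fun a => A.step (z a) (g a) :=
  Continuous.measurable2 (c := A.step) hstep hz hg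

variable {Ω : Type*} {mΩ : MeasurableSpace Ω} {ℱ : Filtration ℕ mΩ}
  {T : ℕ} {loss : ℕ → Ω → Vec d → ℝ} {s : ℕ → Ω → sphere (0 : Vec d) 1}

/-- The directions and the feedback are adapted. -/
theorem Input.measurable_dir_feedback (hV : ∀ t, Measurable (A.V t)) (hreg : Continuous A.reg)
    (hstep : Continuous fun p : Vec d × Vec d => A.step p.1 p.2)
    (hloss : ∀ t < T, Measurable[(ℱ t).prod inferInstance] fun p : Ω × Vec d => loss t p.1 p.2)
    (hs : ∀ t < T, Measurable[ℱ (t + 1)] (s t)) (t : ℕ) (ht : t ≤ T) :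
    Measurable[ℱ t] (fun ω => A.dir (fun i => loss i ω) (fun i => s i ω) t) ∧
      ∀ i < t, Measurable[ℱ t] fun ω => A.feedback (fun i => loss i ω) (fun i => s i ω) i := by
  induction t with
  | zero =>
    exact ⟨@measurable_const _ _ _ (ℱ 0) 0, fun i hi => absurd hi (Nat.not_lt_zero i)⟩
  | succ t ih =>
    obtain ⟨hz, hf⟩ := ih (by omega)
    have hle : ℱ t ≤ ℱ (t + 1) := ℱ.mono t.le_succ
    have hz' := hz.mono hle le_rfl
    have hv : Measurable[ℱ (t + 1)]
        fun ω => A.scale (fun i => loss i ω) (fun i => s i ω) t := by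
      simp only [Input.scale_eq]
      exact ScalingAlg.measurable_run (hV t) fun i hi => (hf i hi).mono hle le_rfl
    have hl : Measurable[(ℱ (t + 1)).prod inferInstance] fun p : Ω × Vec d => loss t p.1 p.2 :=
      (hloss t (by omega)).mono (sup_le_sup (MeasurableSpace.comap_mono hle) le_rfl) le_rfl
    have hst : Measurable[ℱ (t + 1)] fun ω => (s t ω : Vec d) :=
      measurable_subtype_coe.comp (hs t (by omega))
    have hg : Measurable[ℱ (t + 1)]
        fun ω => A.gradEst (fun i => loss i ω) (fun i => s i ω) t :=
      Input.measurable_estimate (m := ℱ (t + 1)) hl hv hz' hst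
    refine ⟨?_, fun i hi => ?_⟩
    · simp only [Input.dir_succ]
      exact Input.measurable_step (m := ℱ (t + 1)) hstep hz' hg
    · rcases Nat.lt_succ_iff_lt_or_eq.1 hi with hi | rfl
      · exact (hf i hi).mono hle le_rfl
      · exact Input.measurable_deriv_surrogate (m := ℱ (i + 1)) hreg hv hz' hg

theorem Input.measurable_scale (hV : ∀ t, Measurable (A.V t)) (hreg : Continuous A.reg)
    (hstep : Continuous fun p : Vec d × Vec d => A.step p.1 p.2)
    (hloss : ∀ t < T, Measurable[(ℱ t).prod inferInstance] fun p : Ω × Vec d => loss t p.1 p.2)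
    (hs : ∀ t < T, Measurable[ℱ (t + 1)] (s t)) (t : ℕ) (ht : t ≤ T) :
    Measurable[ℱ t] fun ω => A.scale (fun i => loss i ω) (fun i => s i ω) t := by
  simp only [Input.scale_eq]
  exact ScalingAlg.measurable_run (hV t)
    (A.measurable_dir_feedback hV hreg hstep hloss hs t ht).2

end Adapted

/-! ### Expected regret of one round. -/

section OneRound

variable {d : ℕ} [Nontrivial (Vec d)] {A : Input d} {Ω Ω' : Type*} {mΩ : MeasurableSpace Ω}
  {mΩ' : MeasurableSpace Ω'} {μ : Measure Ω} [IsProbabilityMeasure μ] {Y : Ω → Ω'}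
  {s : Ω → sphere (0 : Vec d) 1}

/-- The expected regret of one round is at most the expected regret on the linearized loss. -/
theorem Input.integral_point_sub_inner_le {W : Set (Vec d)} (hWc : IsClosed W) {L : ℝ} (hL : 0 ≤ L)
    (hδ : 0 < A.δ) (hY : Measurable Y) (hs : Measurable s) (hind : IndepFun Y s μ)
    (hlaw : μ.map s = uniformSphere d) {f : Ω' → Vec d → ℝ}
    (hf : Measurable fun p : Ω' × Vec d => f p.1 p.2) (hconv : ∀ ω, ConvexOn ℝ W (f ω))
    (hlip : ∀ ω, ∀ x ∈ W, ∀ y ∈ W, |f ω y - f ω x| ≤ L * ‖y - x‖)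
    {v : Ω' → ℝ} {z : Ω' → Vec d} (hv : Measurable v) (hz : Measurable z)
    (hv0 : ∀ᵐ ω ∂μ, 0 < v (Y ω)) (hplay : ∀ᵐ ω ∂μ, A.point (v (Y ω)) (z (Y ω)) (s ω) ∈ W)
    {y : Vec d} (hy : y ∈ W) (hreg : ∀ v, 0 < v → 0 ≤ A.reg v)
    (hgap : ∀ ω, ∀ v : ℝ, 0 < v → ∀ z : Vec d, closedBall (v • z) (v * A.δ) ⊆ W →
      ∀ s : Vec d, ‖s‖ = 1 → ∀ ρ ∈ Icc (0 : ℝ) 1,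
      (1 + ρ) / 2 * f ω (v • z + (v * A.δ) • s)
          + (1 - ρ) / 2 * f ω (v • z + (v * A.δ) • -s) ≤
        f ω (v • z + (v * A.δ) • ρ • s) + A.reg v / 2 * (1 - ρ ^ 2))
    (hint : Integrable (fun ω => f (Y ω) (A.point (v (Y ω)) (z (Y ω)) (s ω))
      - inner ℝ (v (Y ω) • z (Y ω) - y) (A.estimate (f (Y ω)) (v (Y ω)) (z (Y ω)) (s ω))) μ)
    (hψ : Integrable (fun ω => f (Y ω) y + A.reg (v (Y ω))) μ) :
    ∫ ω, (f (Y ω) (A.point (v (Y ω)) (z (Y ω)) (s ω))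
      - inner ℝ (v (Y ω) • z (Y ω) - y) (A.estimate (f (Y ω)) (v (Y ω)) (z (Y ω)) (s ω))) ∂μ ≤
      ∫ ω, (f (Y ω) y + A.reg (v (Y ω))) ∂μ := by
  have hcoe : Measurable fun p : Ω' × sphere (0 : Vec d) 1 => (p.2 : Vec d) :=
    measurable_subtype_coe.comp measurable_snd
  have hv' : Measurable fun p : Ω' × sphere (0 : Vec d) 1 => v p.1 := hv.comp measurable_fst
  have hz' : Measurable fun p : Ω' × sphere (0 : Vec d) 1 => z p.1 := hz.comp measurable_fst
  have hf' : Measurable fun q : (Ω' × sphere (0 : Vec d) 1) × Vec d => f q.1.1 q.2 :=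
    hf.comp ((measurable_fst.comp measurable_fst).prodMk measurable_snd)
  have hΦ : Measurable fun p : Ω' × sphere (0 : Vec d) 1 =>
      f p.1 (A.point (v p.1) (z p.1) p.2)
        - inner ℝ (v p.1 • z p.1 - y) (A.estimate (f p.1) (v p.1) (z p.1) p.2) :=
    (A.measurable_apply_point hf' hv' hz' hcoe).sub
      (((hv'.smul hz').sub_const y).inner (A.measurable_estimate hf' hv' hz' hcoe))
  have hmem := hind.ae_ae_of_ae hY hs
    (P := fun p : Ω' × sphere (0 : Vec d) 1 => A.point (v p.1) (z p.1) p.2 ∈ W)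
    (hWc.measurableSet.preimage (A.measurable_point hv' hz' hcoe)) hplay
  refine hind.integral_le hY hs hΦ hint hψ ?_
  filter_upwards [hv0, hmem] with ω hω hωW
  rw [hlaw] at hωW ⊢
  -- For almost every past, almost every sample is safe. Safe samples form a closed set and the
  -- uniform law charges every nonempty open set, so all samples are safe.
  have hall : ∀ σ : sphere (0 : Vec d) 1, A.point (v (Y ω)) (z (Y ω)) σ ∈ W := by
    have hcl : IsClosed {σ : sphere (0 : Vec d) 1 | A.point (v (Y ω)) (z (Y ω)) σ ∈ W} :=
      hWc.preimage (by unfold Input.point; fun_prop)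
    have := (Measure.dense_of_ae hωW).closure_eq
    rw [hcl.closure_eq] at this
    exact fun σ => this.ge (mem_univ σ)
  have := integral_point_sub_estimate_le (A := A) (hconv (Y ω)) hL (hlip (Y ω)) (mul_pos hω hδ)
    hall hy (div_nonneg (hreg _ hω) zero_le_two) (hgap (Y ω) _ hω _)
  linarith

end OneRound

/-! ### Summation over the rounds in expectation. -/

section Regret

variable {d : ℕ} {A : Input d} {Ω : Type*} {mΩ : MeasurableSpace Ω} {μ : Measure Ω}
  {ℱ : Filtration ℕ mΩ} {T : ℕ}
  {loss : ℕ → Ω → Vec d → ℝ} {s : ℕ → Ω → sphere (0 : Vec d) 1} {W : Set (Vec d)} {L : ℝ}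

/-- The whole past is one random variable: the identity into `Ω` equipped with `ℱ t`. -/
theorem IsUniformSampling.indepFun_id (h : IsUniformSampling μ ℱ T s) {t : ℕ} (ht : t < T) :
    @IndepFun Ω Ω (sphere (0 : Vec d) 1) mΩ (ℱ t) inferInstance id (s t) μ := by
  rw [@IndepFun_iff_Indep Ω Ω (sphere (0 : Vec d) 1) mΩ (ℱ t) inferInstance,
    @MeasurableSpace.comap_id _ (ℱ t)]
  exact (h.indep t ht).symm

theorem IsEnvironment.abs_le (h : IsEnvironment ℱ T W L loss) (h0 : 0 ∈ W) {t : ℕ} (ht : t < T)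
    (ω : Ω) {x : Vec d} (hx : x ∈ W) : |loss t ω x| ≤ L * ‖x‖ := by
  simpa [h.zero t ht ω] using h.lipschitz t ht ω 0 h0 x hx

variable [Nontrivial (Vec d)] [IsProbabilityMeasure μ]

/-- The expected regret, for losses that are jointly measurable on the whole space. -/
theorem Input.expected_regret_le_of_measurable (hWconv : Convex ℝ W) (hWc : IsClosed W)
    (h0 : 0 ∈ W) (hL : 0 ≤ L) (hδ : 0 < A.δ) (hδ1 : A.δ ≤ 1) (hα : A.α ∈ Icc (0 : ℝ) 1)
    (hS : IsCompact ((1 - A.α) • A.Z)) (hc : Convex ℝ ((1 - A.α) • A.Z))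
    (h1 : (1 - A.α) • A.Z ⊆ closedBall 0 1) (hη : 0 < A.η)
    (hV : ∀ t, Measurable (A.V t)) {l : Set ℝ} (hl : l ⊆ Ioi 0) {LV C : ℝ} {k : ℕ}
    (hA : ImplementsScaling A.V l T LV C k) (hreg : IsRegularizer A.reg)
    (henv : IsEnvironment ℱ T W L loss) (hsamp : IsUniformSampling μ ℱ T s)
    (hloss : ∀ t < T, Measurable[(ℱ t).prod inferInstance] fun p : Ω × Vec d => loss t p.1 p.2)
    (hgap : ∀ t < T, ∀ ω, ∀ v : ℝ, 0 < v → ∀ z : Vec d, closedBall (v • z) (v * A.δ) ⊆ W →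
      ∀ s : Vec d, ‖s‖ = 1 → ∀ ρ ∈ Icc (0 : ℝ) 1,
      (1 + ρ) / 2 * loss t ω (v • z + (v * A.δ) • s)
          + (1 - ρ) / 2 * loss t ω (v • z + (v * A.δ) • -s) ≤
        loss t ω (v • z + (v * A.δ) • ρ • s) + A.reg v / 2 * (1 - ρ ^ 2))
    {u y : Vec d} (hu : u ∈ W) {v : ℝ} (hv : v ∈ l) (hy : y ∈ (1 - A.α) • A.Z)
    (huy : v • y = (1 - A.α) • u)
    (hplay : ∀ᵐ ω ∂μ, ∀ t < T, A.play (fun i => loss i ω) (fun i => s i ω) t ∈ W)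
    (hfeed : ∀ᵐ ω ∂μ, ∀ t < T, |A.feedback (fun i => loss i ω) (fun i => s i ω) t| ≤ LV) :
    Integrable (fun ω => A.regret T u (fun i => loss i ω) (fun i => s i ω)) μ ∧
    ∫ ω, A.regret T u (fun i => loss i ω) (fun i => s i ω) ∂μ ≤
      C * logFactor k (T + |v| + LV) * (1 + |v| * LV * √(T : ℝ)) + T * A.reg v
        + v * (1 / A.η + A.η / 4 * (T * (2 * d * L / A.δ) ^ 2)) + T * (L * (A.α * ‖u‖)) := by
  have hne : ((1 - A.α) • A.Z).Nonempty := ⟨y, hy⟩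
  have hstep := A.continuous_step hS hne hc
  have hv0 : 0 < v := hl hv
  -- The segment may be unbounded; `M` is what makes every term below integrable.
  obtain ⟨M, hM⟩ := hA.exists_run_le hl ⟨v, hv⟩
  set vt : ℕ → Ω → ℝ := fun t ω => A.scale (fun i => loss i ω) (fun i => s i ω) t with hvt
  set zt : ℕ → Ω → Vec d := fun t ω => A.dir (fun i => loss i ω) (fun i => s i ω) t with hzt
  set wt : ℕ → Ω → Vec d := fun t ω => A.play (fun i => loss i ω) (fun i => s i ω) t with hwt
  set gt : ℕ → Ω → Vec d := fun t ω => A.gradEst (fun i => loss i ω) (fun i => s i ω) t with hgt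
  have hvm : ∀ t < T, Measurable[ℱ t] (vt t) := fun t ht =>
    A.measurable_scale hV hreg.continuous hstep hloss hsamp.measurable t ht.le
  have hzm : ∀ t < T, Measurable[ℱ t] (zt t) := fun t ht =>
    (A.measurable_dir_feedback hV hreg.continuous hstep hloss hsamp.measurable t ht.le).1
  have hvm' : ∀ t < T, Measurable (vt t) := fun t ht => (hvm t ht).mono (ℱ.le t) le_rfl
  have hzm' : ∀ t < T, Measurable (zt t) := fun t ht => (hzm t ht).mono (ℱ.le t) le_rfl
  have hsm : ∀ t < T, Measurable (s t) := fun t ht =>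
    (hsamp.measurable t ht).mono (ℱ.le _) le_rfl
  have hsm' : ∀ t < T, Measurable fun ω => (s t ω : Vec d) := fun t ht =>
    measurable_subtype_coe.comp (hsm t ht)
  have hlm : ∀ t < T, Measurable fun p : Ω × Vec d => loss t p.1 p.2 := fun t ht =>
    (hloss t ht).mono (sup_le_sup (MeasurableSpace.comap_mono (ℱ.le t)) le_rfl) le_rfl
  have hgm : ∀ t < T, Measurable (gt t) := fun t ht =>
    A.measurable_estimate (hlm t ht) (hvm' t ht) (hzm' t ht) (hsm' t ht)
  have ham : ∀ t < T, Measurable fun ω => loss t ω (wt t ω) := fun t ht =>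
    A.measurable_apply_point (hlm t ht) (hvm' t ht) (hzm' t ht) (hsm' t ht)
  have hxm : ∀ t < T, ∀ x, Measurable fun ω => loss t ω x := fun t ht x =>
    (hlm t ht).comp (measurable_id.prodMk measurable_const)
  have hz1 : ∀ t ω, ‖zt t ω‖ ≤ 1 := fun t ω => A.norm_dir_le_one hS hne hc h1 _ _ t
  have hvl : ∀ᵐ ω ∂μ, ∀ t < T, vt t ω ∈ l ∧ vt t ω ≤ M := by
    filter_upwards [hfeed] with ω hω t ht
    refine ⟨A.scale_mem hA hω ht, ?_⟩
    simp only [hvt, Input.scale_eq]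
    exact hM _ hω t ht
  have hvpos : ∀ t < T, ∀ᵐ ω ∂μ, 0 < vt t ω := fun t ht => hvl.mono fun ω hω => hl (hω t ht).1
  have hgb : ∀ᵐ ω ∂μ, ∀ t < T, ‖gt t ω‖ ≤ 2 * d * L / A.δ := by
    filter_upwards [hplay, hvl] with ω hω hωv t ht
    exact A.norm_estimate_le (hl (hωv t ht).1) hδ hδ1 (hz1 t ω) (by simp) hL
      (henv.abs_le h0 ht ω (hω t ht))
  have hai : ∀ t < T, Integrable (fun ω => loss t ω (wt t ω)) μ := fun t ht => by
    refine Integrable.of_bound (ham t ht).aestronglyMeasurable (L * (M * 2)) ?_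
    filter_upwards [hplay, hvl] with ω hω hωv
    refine (henv.abs_le h0 ht ω (hω t ht)).trans (mul_le_mul_of_nonneg_left ?_ hL)
    exact (A.norm_point_le (le_of_lt (hl (hωv t ht).1)) hδ.le hδ1 (hz1 t ω) (by simp)).trans
      (mul_le_mul_of_nonneg_right (hωv t ht).2 zero_le_two)
  have hbi : ∀ t < T, Integrable (fun ω => inner ℝ (vt t ω • zt t ω - v • y) (gt t ω)) μ :=
    fun t ht => by
    refine Integrable.of_bound ((((hvm' t ht).smul (hzm' t ht)).sub_const _).inner
      (hgm t ht)).aestronglyMeasurable ((M + ‖v • y‖) * (2 * d * L / A.δ)) ?_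
    filter_upwards [hgb, hvl] with ω hω hωv
    have hvp : 0 < vt t ω := hl (hωv t ht).1
    refine (norm_inner_le_norm _ _).trans (mul_le_mul ?_ (hω t ht) (norm_nonneg _)
      (add_nonneg (hvp.le.trans (hωv t ht).2) (norm_nonneg _)))
    refine (norm_sub_le _ _).trans (add_le_add ?_ le_rfl)
    rw [norm_smul, Real.norm_of_nonneg hvp.le]
    exact (mul_le_of_le_one_right hvp.le (hz1 t ω)).trans (hωv t ht).2
  have hxi : ∀ t < T, ∀ x ∈ W, Integrable (fun ω => loss t ω x) μ := fun t ht x hx =>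
    Integrable.of_bound (hxm t ht x).aestronglyMeasurable (L * ‖x‖)
      (ae_of_all _ fun ω => henv.abs_le h0 ht ω hx)
  have hei : ∀ t < T, Integrable (fun ω => A.reg (vt t ω)) μ := fun t ht => by
    obtain ⟨R, hR⟩ := (isCompact_Icc (a := (0 : ℝ)) (b := M)).exists_bound_of_continuousOn
      hreg.continuous.continuousOn
    refine Integrable.of_bound
      (hreg.continuous.measurable.comp (hvm' t ht)).aestronglyMeasurable R ?_
    filter_upwards [hvl] with ω hωv
    exact hR _ ⟨le_of_lt (hl (hωv t ht).1), (hωv t ht).2⟩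
  have hyW : v • y ∈ W := by
    rw [huy]
    have := hWconv h0 hu hα.1 (by linarith [hα.2] : 0 ≤ 1 - A.α) (by ring)
    simpa using this
  have hround : ∀ t < T, ∫ ω, (loss t ω (wt t ω) - loss t ω u) ∂μ ≤
      ∫ ω, (inner ℝ (vt t ω • zt t ω - v • y) (gt t ω) + A.reg (vt t ω)) ∂μ
        + L * (A.α * ‖u‖) := by
    intro t ht
    have hone := Input.integral_point_sub_inner_le (A := A) (mΩ' := ℱ t) (Y := id) hWc hL hδ
      (measurable_id'' (ℱ.le t)) (hsm t ht) (hsamp.indepFun_id ht) (hsamp.law t ht)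
      (hloss t ht) (henv.convex t ht) (henv.lipschitz t ht) (hvm t ht) (hzm t ht)
      (hvpos t ht) (hplay.mono fun ω hω => hω t ht) hyW hreg.nonneg (hgap t ht)
      ((hai t ht).sub (hbi t ht)) ((hxi t ht _ hyW).add (hei t ht))
    have e1 := integral_sub (hai t ht) (hbi t ht)
    have e2 := integral_add (hxi t ht _ hyW) (hei t ht)
    have e3 := integral_add (hbi t ht) (hei t ht)
    have e4 := integral_sub (hai t ht) (hxi t ht u hu)
    have e5 := integral_sub (hxi t ht _ hyW) (hxi t ht u hu)
    have e6 : ∫ ω, (loss t ω (v • y) - loss t ω u) ∂μ ≤ L * (A.α * ‖u‖) := by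
      have : ∫ ω, (loss t ω (v • y) - loss t ω u) ∂μ ≤ ∫ _ω, L * (A.α * ‖u‖) ∂μ := by
        refine integral_mono ((hxi t ht _ hyW).sub (hxi t ht u hu)) (integrable_const _)
          fun ω => ?_
        refine (le_abs_self _).trans ((henv.lipschitz t ht ω u hu _ hyW).trans (le_of_eq ?_))
        rw [huy, sub_smul, one_smul, sub_sub_cancel_left, norm_neg, norm_smul,
          Real.norm_of_nonneg hα.1]
      simpa using this
    have hone' : ∫ ω, (loss t ω (wt t ω) - inner ℝ (vt t ω • zt t ω - v • y) (gt t ω)) ∂μ ≤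
      ∫ ω, (loss t ω (v • y) + A.reg (vt t ω)) ∂μ := hone
    linarith
  have hterm : ∀ t ∈ Finset.range T,
      Integrable (fun ω => loss t ω (wt t ω) - loss t ω u) μ := fun t ht =>
    (hai t (Finset.mem_range.1 ht)).sub (hxi t (Finset.mem_range.1 ht) u hu)
  refine ⟨integrable_finsetSum _ hterm, ?_⟩
  have hlin : ∀ t ∈ Finset.range T, Integrable
      (fun ω => inner ℝ (vt t ω • zt t ω - v • y) (gt t ω) + A.reg (vt t ω)) μ := fun t ht =>
    (hbi t (Finset.mem_range.1 ht)).add (hei t (Finset.mem_range.1 ht))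
  have hpath : ∫ ω, ∑ t ∈ Finset.range T,
      (inner ℝ (vt t ω • zt t ω - v • y) (gt t ω) + A.reg (vt t ω)) ∂μ ≤
      C * logFactor k (T + |v| + LV) * (1 + |v| * LV * √(T : ℝ)) + T * A.reg v
        + v * (1 / A.η + A.η / 4 * (T * (2 * d * L / A.δ) ^ 2)) := by
    refine (integral_mono_ae (integrable_finsetSum _ hlin) (integrable_const _) ?_).trans_eq
      (by rw [integral_const, probReal_univ, one_smul])
    filter_upwards [hgb, hfeed] with ω hω hωf
    exact A.sum_surrogate_le hA hl hreg hS hc h1 hη hv hy hω hωf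
  calc ∫ ω, A.regret T u (fun i => loss i ω) (fun i => s i ω) ∂μ
      = ∑ t ∈ Finset.range T, ∫ ω, (loss t ω (wt t ω) - loss t ω u) ∂μ :=
        integral_finsetSum _ hterm
    _ ≤ ∑ t ∈ Finset.range T, (∫ ω, (inner ℝ (vt t ω • zt t ω - v • y) (gt t ω)
          + A.reg (vt t ω)) ∂μ + L * (A.α * ‖u‖)) :=
        Finset.sum_le_sum fun t ht => hround t (Finset.mem_range.1 ht)
    _ = ∫ ω, ∑ t ∈ Finset.range T,
          (inner ℝ (vt t ω • zt t ω - v • y) (gt t ω) + A.reg (vt t ω)) ∂μ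
          + T * (L * (A.α * ‖u‖)) := by
        rw [Finset.sum_add_distrib, integral_finsetSum _ hlin, Finset.sum_const, Finset.card_range,
          nsmul_eq_mul]
    _ ≤ _ := by gcongr

end Regret

/-! ### Replacing the losses by zero outside `W`. -/

section Truncation

variable {d : ℕ} {A : Input d} {W : Set (Vec d)}

/-- Measurability in the parameter and continuity on `W` give joint measurability on `W`. Sending
outside points to `0`, where the functions vanish, extends this to the whole space. -/
theorem measurable_indicator_of_continuousOn {α : Type*} {m : MeasurableSpace α}
    {f : α → Vec d → ℝ} (hW : IsClosed W) (h0 : 0 ∈ W) (hf0 : ∀ a, f a 0 = 0)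
    (hm : ∀ x ∈ W, Measurable fun a => f a x) (hcont : ∀ a, ContinuousOn (f a) W) :
    Measurable fun p : α × Vec d => W.indicator (f p.1) p.2 := by
  classical
  have h1 : Measurable (Function.uncurry fun (x : W) (a : α) => f a x) :=
    measurable_uncurry_of_continuous_of_measurable
      (fun a => continuousOn_iff_continuous_domRestrict.1 (hcont a)) fun x => hm x x.2
  have hπ : Measurable fun x : Vec d => (⟨if x ∈ W then x else 0, by
      split_ifs with h
      · exact h
      · exact h0⟩ : W) :=
    (Measurable.ite hW.measurableSet measurable_id measurable_const).subtype_mk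
  have h2 := h1.comp ((hπ.comp measurable_snd).prodMk (measurable_fst (α := α) (β := Vec d)))
  convert h2 using 1
  funext p
  by_cases h : p.2 ∈ W <;> simp [Function.uncurry, h, hf0]

/-- The algorithm evaluates losses only at its plays, so truncation is invisible while these stay in
`W`. -/
theorem Input.state_indicator {f : ℕ → Vec d → ℝ} {s : ℕ → Vec d} {T : ℕ}
    (h : ∀ t < T, A.play f s t ∈ W) {t : ℕ} (ht : t ≤ T) :
    A.state (fun i => W.indicator (f i)) s t = A.state f s t := by
  induction t with
  | zero => rfl
  | succ t ih =>
    have hst := ih (by omega)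
    have hp : A.point (A.V t (A.state f s t).2) (A.state f s t).1 (s t) ∈ W := h t (by omega)
    have he : A.estimate (W.indicator (f t)) (A.V t (A.state f s t).2) (A.state f s t).1 (s t) =
        A.estimate (f t) (A.V t (A.state f s t).2) (A.state f s t).1 (s t) := by
      rw [Input.estimate, Input.estimate, indicator_of_mem hp]
    simp only [Input.state, hst, he]

theorem Input.play_indicator {f : ℕ → Vec d → ℝ} {s : ℕ → Vec d} {T : ℕ}
    (h : ∀ t < T, A.play f s t ∈ W) {t : ℕ} (ht : t < T) :
    A.play (fun i => W.indicator (f i)) s t = A.play f s t := by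
  rw [Input.play, Input.play, Input.scale, Input.scale, Input.dir, Input.dir,
    A.state_indicator h ht.le]

theorem Input.feedback_indicator {f : ℕ → Vec d → ℝ} {s : ℕ → Vec d} {T : ℕ}
    (h : ∀ t < T, A.play f s t ∈ W) {t : ℕ} (ht : t < T) :
    A.feedback (fun i => W.indicator (f i)) s t = A.feedback f s t := by
  have h1 := congrFun (A.state_snd (fun i => W.indicator (f i)) s (t + 1)) (Fin.last t)
  have h2 := congrFun (A.state_snd f s (t + 1)) (Fin.last t)
  rw [A.state_indicator h (Nat.succ_le_of_lt ht)] at h1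
  exact h1.symm.trans h2

theorem Input.regret_indicator {f : ℕ → Vec d → ℝ} {s : ℕ → Vec d} {T : ℕ} {u : Vec d}
    (hu : u ∈ W) (h : ∀ t < T, A.play f s t ∈ W) :
    A.regret T u (fun i => W.indicator (f i)) s = A.regret T u f s := by
  refine Finset.sum_congr rfl fun t ht => ?_
  have ht := Finset.mem_range.1 ht
  simp only [A.play_indicator h ht, indicator_of_mem (h t ht), indicator_of_mem hu]

end Truncation

section Bound

theorem IsEnvironment.indicator {d : ℕ} {Ω : Type*} {mΩ : MeasurableSpace Ω}
    {ℱ : Filtration ℕ mΩ} {T : ℕ} {loss : ℕ → Ω → Vec d → ℝ} {W : Set (Vec d)} {L : ℝ}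
    (h : IsEnvironment ℱ T W L loss) (h0 : 0 ∈ W) :
    IsEnvironment ℱ T W L fun t ω => W.indicator (loss t ω) where
  measurable t ht x hx := by
    simpa only [indicator_of_mem hx] using h.measurable t ht x hx
  convex t ht ω := (h.convex t ht ω).congr fun x hx => (indicator_of_mem hx _).symm
  lipschitz t ht ω x hx y hy := by
    simpa only [indicator_of_mem hx, indicator_of_mem hy] using h.lipschitz t ht ω x hx y hy
  zero t ht ω := by rw [indicator_of_mem h0, h.zero t ht ω]

variable {d : ℕ} [Nontrivial (Vec d)] {A : Input d} {Ω : Type*} {mΩ : MeasurableSpace Ω}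
  {μ : Measure Ω} [IsProbabilityMeasure μ] {ℱ : Filtration ℕ mΩ} {T : ℕ}
  {loss : ℕ → Ω → Vec d → ℝ} {s : ℕ → Ω → sphere (0 : Vec d) 1} {W : Set (Vec d)} {L : ℝ}

theorem Input.expected_regret_le (hWconv : Convex ℝ W) (hWc : IsClosed W)
    (h0 : 0 ∈ W) (hL : 0 ≤ L) (hδ : 0 < A.δ) (hδ1 : A.δ ≤ 1) (hα : A.α ∈ Icc (0 : ℝ) 1)
    (hZ : Convex ℝ A.Z) (hZc : IsClosed A.Z) (hZ1 : A.Z ⊆ closedBall 0 1) (hη : 0 < A.η)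
    (hV : ∀ t, Measurable (A.V t)) {l : Set ℝ} (hl : l ⊆ Ioi 0) {LV C : ℝ} {k : ℕ}
    (hA : ImplementsScaling A.V l T LV C k) (hreg : IsRegularizer A.reg)
    (henv : IsEnvironment ℱ T W L loss) (hsamp : IsUniformSampling μ ℱ T s)
    (hgap : ∀ t < T, ∀ ω, ∀ v : ℝ, 0 < v → ∀ z : Vec d, closedBall (v • z) (v * A.δ) ⊆ W →
      ∀ s : Vec d, ‖s‖ = 1 → ∀ ρ ∈ Icc (0 : ℝ) 1,
      (1 + ρ) / 2 * loss t ω (v • z + (v * A.δ) • s)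
          + (1 - ρ) / 2 * loss t ω (v • z + (v * A.δ) • -s) ≤
        loss t ω (v • z + (v * A.δ) • ρ • s) + A.reg v / 2 * (1 - ρ ^ 2))
    {u z : Vec d} (hu : u ∈ W) {v : ℝ} (hv : v ∈ l) (hz : z ∈ A.Z) (huz : v • z = u)
    (hplay : ∀ᵐ ω ∂μ, ∀ t < T, A.play (fun i => loss i ω) (fun i => s i ω) t ∈ W)
    (hfeed : ∀ᵐ ω ∂μ, ∀ t < T, |A.feedback (fun i => loss i ω) (fun i => s i ω) t| ≤ LV) :
    Integrable (fun ω => A.regret T u (fun i => loss i ω) (fun i => s i ω)) μ ∧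
    ∫ ω, A.regret T u (fun i => loss i ω) (fun i => s i ω) ∂μ ≤
      C * logFactor k (T + |v| + LV) * (1 + |v| * LV * √(T : ℝ)) + T * A.reg v
        + v * (1 / A.η + A.η / 4 * (T * (2 * d * L / A.δ) ^ 2)) + T * (L * (A.α * ‖u‖)) := by
  have hS : IsCompact ((1 - A.α) • A.Z) :=
    ((isCompact_closedBall (0 : Vec d) 1).of_isClosed_subset hZc hZ1).smul _
  have h1 : (1 - A.α) • A.Z ⊆ closedBall 0 1 := by
    rintro _ ⟨x, hx, rfl⟩
    have hx1 : ‖x‖ ≤ 1 := by simpa using hZ1 hx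
    rw [mem_closedBall_zero_iff, norm_smul, Real.norm_of_nonneg (by linarith [hα.2])]
    exact mul_le_one₀ (by linarith [hα.1]) (norm_nonneg _) hx1
  have henv' := henv.indicator h0
  have hloss : ∀ t < T, Measurable[(ℱ t).prod inferInstance]
      fun p : Ω × Vec d => W.indicator (loss t p.1) p.2 := fun t ht =>
    measurable_indicator_of_continuousOn (m := ℱ t) hWc h0 (henv.zero t ht)
      (henv.measurable t ht) fun ω => (LipschitzOnWith.of_dist_le_mul (K := L.toNNReal)
        fun a ha b hb => by
          rw [Real.dist_eq, dist_eq_norm, Real.coe_toNNReal _ hL]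
          exact henv.lipschitz t ht ω b hb a ha).continuousOn
  have hreg_eq : (fun ω => A.regret T u (fun i => W.indicator (loss i ω)) fun i => s i ω) =ᵐ[μ]
      fun ω => A.regret T u (fun i => loss i ω) fun i => s i ω :=
    hplay.mono fun ω hω => A.regret_indicator hu hω
  have key := A.expected_regret_le_of_measurable hWconv hWc h0 hL hδ hδ1 hα hS (hZ.smul _) h1 hη
    hV hl hA hreg henv' hsamp hloss (fun t ht ω v hv z hb σ hσ ρ hρ => by
      have hm : ∀ p : Vec d, ‖p‖ ≤ 1 → v • z + (v * A.δ) • p ∈ W := fun p hp => hb (by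
        rw [mem_closedBall, dist_eq_norm, add_sub_cancel_left, norm_smul,
          Real.norm_of_nonneg (by positivity)]
        exact mul_le_of_le_one_right (by positivity) hp)
      rw [indicator_of_mem (hm _ hσ.le), indicator_of_mem (hm (-σ) (by rw [norm_neg, hσ])),
        indicator_of_mem (hm (ρ • σ) (by
          rw [norm_smul, hσ, mul_one, Real.norm_of_nonneg hρ.1]; exact hρ.2))]
      exact hgap t ht ω v hv z hb σ hσ ρ hρ) hu hv (smul_mem_smul_set hz)
    (by rw [smul_comm, huz])
    (hplay.mono fun ω hω t ht => by rw [A.play_indicator hω ht]; exact hω t ht)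
    (by
      filter_upwards [hplay, hfeed] with ω hω hωf t ht
      rw [A.feedback_indicator hω ht]
      exact hωf t ht)
  rw [integrable_congr hreg_eq, integral_congr_ae hreg_eq] at key
  exact key

end Bound

/-! ### Regularizers, learning rate and constants. -/

section Constants

theorem isRegularizer_lipReg {δ L : ℝ} (hδ : 0 ≤ δ) (hL : 0 ≤ L) : IsRegularizer (lipReg δ L) := by
  have hd : ∀ v, 0 < v → HasDerivAt (lipReg δ L) (2 * δ * L) v := fun v hv => by
    have h := (hasDerivAt_abs_pos hv).const_mul (2 * δ * L)
    rwa [mul_one] at h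
  refine ⟨by unfold lipReg; fun_prop, fun v hv => (hd v hv).differentiableAt,
    fun a ha b hb => ?_, fun v _ => by unfold lipReg; positivity⟩
  rw [(hd a ha).deriv, lipReg, lipReg, abs_of_pos ha, abs_of_pos hb]
  exact le_of_eq (by ring)

theorem isRegularizer_smoothReg {δ β : ℝ} (hβ : 0 ≤ β) : IsRegularizer (smoothReg δ β) := by
  have hd : ∀ v, HasDerivAt (smoothReg δ β) (β * δ ^ 2 * (2 * v)) v := fun v => by
    have h := (hasDerivAt_pow 2 v).const_mul (β * δ ^ 2)
    rwa [Nat.cast_ofNat, Nat.add_one_sub_one, pow_one] at h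
  refine ⟨by unfold smoothReg; fun_prop, fun v _ => (hd v).differentiableAt,
    fun a _ b _ => ?_, fun v _ => by unfold smoothReg; positivity⟩
  rw [(hd a).deriv, smoothReg, smoothReg]
  have : 0 ≤ β * δ ^ 2 * (a - b) ^ 2 := by positivity
  linarith

theorem learningRate_eq {d T : ℕ} {δ L : ℝ} (hδ : 0 ≤ δ) (hL : 0 ≤ L) :
    learningRate d δ L T = δ / (2 * (d * L) * √(T : ℝ)) := by
  have : δ ^ 2 / (4 * (d * L) ^ 2 * T) = (δ / (2 * (d * L) * √(T : ℝ))) ^ 2 := by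
    rw [div_pow, mul_pow, mul_pow, Real.sq_sqrt (Nat.cast_nonneg T)]
    ring
  rw [learningRate, this, Real.sqrt_sq (by positivity)]

/-- In units of `dL√T/δ`, the two terms are `2` and `1/2`. -/
theorem learningRate_regret {d T : ℕ} (hd : 1 ≤ d) (hT : 1 ≤ T) {δ L : ℝ} (hδ : 0 < δ)
    (hL : 0 < L) :
    1 / learningRate d δ L T
        + learningRate d δ L T / 4 * (T * (2 * d * L / δ) ^ 2) = 5 / 2 * (d * L / δ * √(T : ℝ)) := by
  have hd' : (0 : ℝ) < d := by exact_mod_cast hd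
  have hT' : (0 : ℝ) < T := by exact_mod_cast hT
  have hs : 0 < √(T : ℝ) := Real.sqrt_pos.2 hT'
  have hsq : (T : ℝ) = √(T : ℝ) ^ 2 := (Real.sq_sqrt hT'.le).symm
  rw [learningRate_eq hδ.le hL.le]
  conv_lhs => rw [hsq]
  rw [Real.sqrt_sq hs.le]
  field_simp
  ring

theorem one_le_logFactor (k : ℕ) {x : ℝ} (hx : 0 ≤ x) : 1 ≤ logFactor k x := by
  refine one_le_pow₀ ?_
  rw [Real.le_log_iff_exp_le (by positivity)]
  linarith

/-- `C` may be negative, hence the maximum; the remainder acquires the logarithmic factor for free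
as `Λ ≥ 1`. -/
theorem mul_add_le_max_add_mul {C K Λ X R S : ℝ} (hK : 0 ≤ K) (hΛ : 1 ≤ Λ) (hX : 0 ≤ X)
    (hXS : X ≤ S) (hR : R ≤ K * S) : C * Λ * X + R ≤ (max C 0 + K) * Λ * S := by
  have h1 : C * Λ * X ≤ max C 0 * Λ * S := by
    have := le_max_left C 0
    have := le_max_right C 0
    gcongr
  have h2 : K * S * 1 ≤ K * S * Λ := by
    have : 0 ≤ S := hX.trans hXS
    gcongr
  linarith

end Constants

end ConvexBandit

end

/-! ### The two regret bounds. -/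

theorem mainTheorem4 (C : ℝ) (k : ℕ) :
    ∃ (C' : ℝ) (k' : ℕ),
      ∀ (d T : ℕ) (_ : 1 ≤ d) (_ : 1 ≤ T)
        -- the norm used for comparators, the decision set, and the direction domain
        (N : Seminorm ℝ (ConvexBandit.Vec d)) (_ : ∀ x, N x = 0 → x = 0)
        (W : Set (ConvexBandit.Vec d)) (_ : Convex ℝ W) (_ : IsClosed W)
        (_ : (interior W).Nonempty) (_ : 0 ∈ W)
        (Z : Set (ConvexBandit.Vec d)) (_ : Convex ℝ Z) (_ : IsClosed Z)
        (_ : Z ⊆ Metric.closedBall 0 1)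
        (L δ α : ℝ) (_ : 1 ≤ L) (_ : δ ∈ Set.Ioc (0 : ℝ) 1) (_ : α ∈ Set.Icc (0 : ℝ) 1)
        -- the scale learner
        (V : ConvexBandit.ScalingAlg) (_ : ∀ t, Measurable (V t))
        (l : Set ℝ) (_ : l ⊆ Set.Ioi 0) (LV : ℝ)
        (_ : ConvexBandit.ImplementsScaling V l T LV C k)
        -- the probability space, the environment, and the random samples
        (Ω : Type*) (mΩ : MeasurableSpace Ω) (μ : Measure Ω) (_ : IsProbabilityMeasure μ)
        (ℱ : Filtration ℕ mΩ)
        (loss : ℕ → Ω → ConvexBandit.Vec d → ℝ) (_ : ConvexBandit.IsEnvironment ℱ T W L loss)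
        (s : ℕ → Ω → Metric.sphere (0 : ConvexBandit.Vec d) 1)
        (_ : ConvexBandit.IsUniformSampling μ ℱ T s)
        -- the comparator
        (u : ConvexBandit.Vec d) (r : ℝ) (_ : u ∈ W) (_ : 0 < r) (_ : N u / r ∈ l)
        (_ : (r / N u) • u ∈ Z),
        -- Lipschitz losses
        (∀ A : ConvexBandit.Input d,
          A = { V := V, δ := δ, α := α, η := ConvexBandit.learningRate d δ L T, Z := Z,
                reg := ConvexBandit.lipReg δ L } →
          (∀ᵐ ω ∂μ, ∀ t < T, A.play (fun i => loss i ω) (fun i => s i ω) t ∈ W) →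
          (∀ᵐ ω ∂μ, ∀ t < T, |A.feedback (fun i => loss i ω) (fun i => s i ω) t| ≤ LV) →
          Integrable (fun ω => A.regret T u (fun i => loss i ω) (fun i => s i ω)) μ ∧
          ∫ ω, A.regret T u (fun i => loss i ω) (fun i => s i ω) ∂μ ≤
            C' * ConvexBandit.logFactor k' (T + N u / r + LV) *
              (1 + T * δ * L * (N u / r) + N u / r * LV * √(T : ℝ) +
                N u * d * L / (r * δ) * √(T : ℝ) + α * ‖u‖ * T * L)) ∧
        -- smooth losses
        (∀ β : ℝ, 1 ≤ β → (∀ t < T, ∀ ω, ConvexBandit.IsSmoothOver β (loss t ω) W) →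
          ∀ A : ConvexBandit.Input d,
          A = { V := V, δ := δ, α := α, η := ConvexBandit.learningRate d δ L T, Z := Z,
                reg := ConvexBandit.smoothReg δ β } →
          (∀ᵐ ω ∂μ, ∀ t < T, A.play (fun i => loss i ω) (fun i => s i ω) t ∈ W) →
          (∀ᵐ ω ∂μ, ∀ t < T, |A.feedback (fun i => loss i ω) (fun i => s i ω) t| ≤ LV) →
          Integrable (fun ω => A.regret T u (fun i => loss i ω) (fun i => s i ω)) μ ∧
          ∫ ω, A.regret T u (fun i => loss i ω) (fun i => s i ω) ∂μ ≤
            C' * ConvexBandit.logFactor k' (T + N u / r + LV) *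
              (1 + T * β * δ ^ 2 * (N u / r) ^ 2 + N u / r * LV * √(T : ℝ) +
                N u / r * (d * L / δ) * √(T : ℝ) + α * ‖u‖ * T * L)) := by
  -- The `3` dominates the factor `2` in the Lipschitz regularizer and the `5/2` of gradient
  -- descent.
  refine ⟨max C 0 + 3, k, ?_⟩
  intro d T hd hT N hN W hWconv hWc _ h0 Z hZ hZc hZ1 L δ α hL hδ hα V hV l hl LV hA Ω mΩ μ hμ ℱ
    loss henv s hsamp u r hu hr hul huz
  have : Nontrivial (ConvexBandit.Vec d) := Module.nontrivial_of_finrank_pos (R := ℝ) (by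
    rw [finrank_euclideanSpace_fin]; exact hd)
  have hv : 0 < N u / r := hl hul
  have hNu : 0 < N u := (div_pos_iff_of_pos_right hr).1 hv
  have hL0 : 0 < L := by linarith
  have hα0 : 0 ≤ α := hα.1
  have hδ0 : 0 < δ := hδ.1
  have hd' : (0 : ℝ) < d := by exact_mod_cast hd
  have hT' : (0 : ℝ) < T := by exact_mod_cast hT
  have hη : 0 < ConvexBandit.learningRate d δ L T := by
    rw [ConvexBandit.learningRate_eq hδ0.le hL0.le]
    positivity
  have hsmul : (N u / r) • (r / N u) • u = u := by
    rw [smul_smul, div_mul_div_cancel₀ hr.ne', div_self hNu.ne', one_smul]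
  -- An almost sure bound holds on some path, and round `0` exists because `T ≥ 1`.
  have hLV : ∀ {p : Ω → ℕ → ℝ}, (∀ᵐ ω ∂μ, ∀ t < T, |p ω t| ≤ LV) → 0 ≤ LV := fun h => by
    obtain ⟨ω, hω⟩ := h.exists
    exact (abs_nonneg _).trans (hω 0 hT)
  refine ⟨?_, ?_⟩
  · rintro A hAeq hplay hfeed
    have hLV0 := hLV hfeed
    subst hAeq
    obtain ⟨hi, hb⟩ := ConvexBandit.Input.expected_regret_le hWconv hWc h0 hL0.le hδ0 hδ.2 hα hZ
      hZc hZ1 hη hV hl hA (ConvexBandit.isRegularizer_lipReg hδ0.le hL0.le) henv hsamp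
      (fun t ht ω v hv z hball σ hσ ρ hρ => by
        have := ConvexBandit.gap_of_lipschitz (henv.lipschitz t ht ω) (by positivity) hball hσ hρ
        simp only [ConvexBandit.lipReg, abs_of_pos hv]
        refine this.trans (le_of_eq (by ring)))
      hu hul huz hsmul hplay hfeed
    refine ⟨hi, hb.trans ?_⟩
    rw [abs_of_pos hv, add_assoc, add_assoc]
    refine ConvexBandit.mul_add_le_max_add_mul (by norm_num)
      (ConvexBandit.one_le_logFactor k (by positivity)) (by positivity) ?_ ?_
    · have : 0 ≤ T * δ * L * (N u / r) + N u * d * L / (r * δ) * √(T : ℝ) + α * ‖u‖ * T * L := by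
        positivity
      linarith
    · simp only [ConvexBandit.learningRate_regret hd hT hδ0 hL0, ConvexBandit.lipReg,
        abs_of_pos hv]
      have e1 : N u / r * (5 / 2 * (d * L / δ * √(T : ℝ))) =
          5 / 2 * (N u * d * L / (r * δ) * √(T : ℝ)) := by field_simp
      have h1 : 0 ≤ T * δ * L * (N u / r) := by positivity
      have h2 : 0 ≤ N u / r * LV * √(T : ℝ) := by positivity
      have h3 : 0 ≤ N u * d * L / (r * δ) * √(T : ℝ) := by positivity
      have h4 : 0 ≤ α * ‖u‖ * T * L := by positivity
      rw [e1]
      linarith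
  · rintro β hβ hsmooth A hAeq hplay hfeed
    have hLV0 := hLV hfeed
    have hβ0 : 0 ≤ β := by linarith
    subst hAeq
    obtain ⟨hi, hb⟩ := ConvexBandit.Input.expected_regret_le hWconv hWc h0 hL0.le hδ0 hδ.2 hα hZ
      hZc hZ1 hη hV hl hA (ConvexBandit.isRegularizer_smoothReg hβ0) henv hsamp
      (fun t ht ω v hv z hball σ hσ ρ hρ => by
        have := ConvexBandit.gap_of_smooth (hsmooth t ht ω) (by positivity) hball hσ hρ
        simp only [ConvexBandit.smoothReg]
        refine this.trans (le_of_eq (by ring)))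
      hu hul huz hsmul hplay hfeed
    refine ⟨hi, hb.trans ?_⟩
    rw [abs_of_pos hv, add_assoc, add_assoc]
    refine ConvexBandit.mul_add_le_max_add_mul (by norm_num)
      (ConvexBandit.one_le_logFactor k (by positivity)) (by positivity) ?_ ?_
    · have : 0 ≤ T * β * δ ^ 2 * (N u / r) ^ 2 + N u / r * (d * L / δ) * √(T : ℝ)
          + α * ‖u‖ * T * L := by
        positivity
      linarith
    · simp only [ConvexBandit.learningRate_regret hd hT hδ0 hL0, ConvexBandit.smoothReg]
      have h1 : 0 ≤ T * β * δ ^ 2 * (N u / r) ^ 2 := by positivity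
      have h2 : 0 ≤ N u / r * LV * √(T : ℝ) := by positivity
      have h3 : 0 ≤ N u / r * (d * L / δ) * √(T : ℝ) := by positivity
      have h4 : 0 ≤ α * ‖u‖ * T * L := by positivity
      linarith
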